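/- Let $K$ be an algebraically closed field that is complete with respect to a non-trivial non-archimedean absolute value $|\cdot|$. Let $d\ge 2$ be an integer, assume that $\operatorname{char}K=0$ or $\operatorname{char}K>d$, and put $$\epsilon=\min\{|m|^d : 1\le m\le d\},$$ where $|m|$ is the absolute value of the integer $m$ in $K$. Then $0<\epsilon\le 1$. Moreover, let $\varphi\in K(z)$ be a rational function of degree $d$, regarded as a self-map of $\mathbb{P}^1(K)=K\cup\{\infty\}$, and let $\gamma\in\mathbb{P}^1(K)$ be a fixed point of $\varphi$ with $$0<|\varphi'(\gamma)|<\epsilon,$$ where, if $\gamma=\infty$, $\varphi'(\gamma)$ means the multiplier, that is, the derivative at $0$ of $1/\varphi(1/z)$. Then there is a critical point $c\in\mathbb{P}^1(K)$ of $\varphi$ (a point at which the derivative of $\varphi$ in local coordinates vanishes) that is strictly attracted to $\gamma$: $\varphi^n(c)\to\gamma$ in $\mathbb{P}^1(K)$ as $n\to\infty$, but $\varphi^l(c)\ne\gamma$ for all $l\ge 1$. -/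

import Mathlib

open scoped OnePoint

noncomputable section

namespace RationalDynamics

/-! The projective line `ℙ¹(K) = K ∪ {∞}` is modelled by the type `OnePoint K`; the topology that
Mathlib puts on `OnePoint K` (a one-point compactification) is *not* the one of `ℙ¹(K)` when `K` is
not locally compact, and it is not used here: convergence is measured by the chordal metric. -/

section Algebra

variable {K : Type*} [Field K]

/-- The degree of a rational function `f / g` in lowest terms: `max (deg f) (deg g)`. -/
def degree (φ : RatFunc K) : ℕ := max φ.num.natDegree φ.denom.natDegree

open Classical in
/-- The value in `ℙ¹(K)` of a rational function at a finite point `a`; it is `∞` at the poles. -/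
def valueAt (φ : RatFunc K) (a : K) : OnePoint K :=
  if φ.denom.eval a = 0 then ∞ else ((φ.eval (RingHom.id K) a : K) : OnePoint K)

/-- The rational function `φ(1/z)`: the map `φ` in the coordinate `1/z` at infinity. -/
def compInv (φ : RatFunc K) : RatFunc K := φ.eval RatFunc.C (RatFunc.X)⁻¹

/-- The self-map of `ℙ¹(K)` that is given by a rational function; its value at `∞` is the value of
`φ(1/z)` at `z = 0`. -/
def toMap (φ : RatFunc K) : OnePoint K → OnePoint K
  | ∞ => valueAt (compInv φ) 0
  | (a : K) => valueAt φ a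

/-- The value at `a` of the derivative `(f' g - f g') / g²` of a rational function `f / g` that has
no pole at `a`. -/
def derivAt (φ : RatFunc K) (a : K) : K :=
  (φ.num.derivative.eval a * φ.denom.eval a - φ.num.eval a * φ.denom.derivative.eval a)
    / (φ.denom.eval a) ^ 2

/-- The rational function `φ` in the standard coordinate of the source at `x`: it is `φ(z)`
if `x` is finite and `φ(1/z)` if `x = ∞`. -/
def sourceForm (φ : RatFunc K) : OnePoint K → RatFunc K
  | ∞ => compInv φ
  | (_ : K) => φ

/-- The value at the point `x` of the standard coordinate at `x` (`z` if `x` is finite, `1/z` if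
`x = ∞`). -/
def coordAt : OnePoint K → K
  | ∞ => 0
  | (a : K) => a

open Classical in
/-- The rational function `φ` in the standard coordinates of the source at `x` and of the target at
`φ(x)`. It has no pole at `coordAt x`. -/
def localForm (φ : RatFunc K) (x : OnePoint K) : RatFunc K :=
  if toMap φ x = ∞ then (sourceForm φ x)⁻¹ else sourceForm φ x

/-- The derivative of `φ` at `x` in the standard coordinates at `x` and at `φ(x)`. If `x` and `φ(x)`
are finite, it is the usual `φ'(x)`. If `x` is a fixed point, the same coordinate is used on both
sides, so that it is the multiplier of the fixed point; for `x = ∞` it is the derivative at `0` of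
the conjugate `1/φ(1/z)`. -/
def localDeriv (φ : RatFunc K) (x : OnePoint K) : K := derivAt (localForm φ x) (coordAt x)

/-- `x` is a critical point of `φ`: the derivative of `φ` at `x` vanishes in local coordinates. -/
def IsCriticalPoint (φ : RatFunc K) (x : OnePoint K) : Prop := localDeriv φ x = 0

end Algebra

section Metric

variable {K : Type*} [NormedField K]

/-- The chordal metric on `ℙ¹(K)` of a non-archimedean field `K`. -/
def chordal : OnePoint K → OnePoint K → ℝ
  | ∞, ∞ => 0
  | ∞, (b : K) => 1 / max 1 ‖b‖
  | (a : K), ∞ => 1 / max 1 ‖a‖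
  | (a : K), (b : K) => ‖a - b‖ / (max 1 ‖a‖ * max 1 ‖b‖)

/-- The point `x` is attracted to the fixed point `γ`: its iterates converge to `γ`. -/
def Attracts (φ : RatFunc K) (γ x : OnePoint K) : Prop :=
  Filter.Tendsto (fun n : ℕ => chordal ((toMap φ)^[n] x) γ) Filter.atTop (nhds 0)

/-- The point `x` is strictly attracted to the fixed point `γ`: its iterates converge to `γ` without
ever reaching it. -/
def StrictlyAttracts (φ : RatFunc K) (γ x : OnePoint K) : Prop :=
  Attracts φ γ x ∧ ∀ l : ℕ, 1 ≤ l → (toMap φ)^[l] x ≠ γ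

/-- The constant `ε = min {|m|^d : 1 ≤ m ≤ d}`, for `d ≥ 1`. -/
def epsilon (K : Type*) [NormedField K] (d : ℕ) (hd : 1 ≤ d) : ℝ :=
  (Finset.Icc 1 d).inf' (Finset.nonempty_Icc.mpr hd) (fun m : ℕ => ‖(m : K)‖ ^ d)

end Metric

end RationalDynamics

end

noncomputable section

namespace RationalDynamics

open Polynomial Metric Filter Topology

/-! Since the multiplier `λ` has absolute value below 1, it is not 1 and `φ` has a second fixed
point; a change of coordinate moves the attracting point to 0 and the other one to `∞`. Then `φ = P
/ Q` with `deg Q < deg P = d`. Let `r` be the least absolute value of a zero or pole other than 0.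
On the open disc of radius `r` one has `|φ(z)| = |λ| |z|`, so a point whose image is nonzero and
smaller than `r` converges to 0 and never reaches it. It remains to find a critical point `w` with
`0 < |φ(w)| < r` (`IsNormalized.exists_critical`).

The tool is the Gauss norm on discs `D(b, t)`. As a function of `t` it is piecewise monomial, and
its exponent is the number of roots in the disc. For the Wronskian `W = P'Q - PQ'`, whose roots are
the finite critical points, two estimates hold: `t |W| ≤ |P| |Q|`, and `|n - m| |P| |Q| ≤ t |W|`,
where `n` and `m` count the zeros and poles in the disc (`le_gaussAt_wronsk`). A nonzero `n - m` has
absolute value at least `μ`, the minimum of `|1|, …, |d|`, and `|λ| < μ ^ d`.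

Going out from 0, some closed disc of radius `R ≥ r` is reached, before `|φ|` attains `r`, in which
`W` has at most one root fewer than `PQ`. Otherwise `|W| / |PQ|` would decay like `t⁻²`, which by
the estimates forces `|φ|` to attain `r` already at radius at most `r / μ`; but up to there `|φ|`
grows by at most `μ⁻ᵈ`, too little to get from `|λ| r` to `r` (`exists_good_radius`). By a similar
argument, going in from `D(0, R)` towards a pole `b`, a disc around `b` is found, before `|φ|`
attains `r`, in which `W` has fewer roots than `PQ` (`exists_hole`).

Remove the maximal discs of this kind from `D(0, R)`. If every critical point left were a zero of
`P`, each distinct zero left and each removed disc would cost `W` one root relative to `PQ`. The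
total deficit is at most one and the zero at 0 uses it up, so there would be no other zero or pole
in `D(0, R)`, contrary to `r ≤ R`. Hence a critical point `w` with `P(w) ≠ 0` is left, and as it
lies outside the removed discs, `|φ(w)| < r`. -/

lemma prod_map_le_prod_map_of_nonneg {ι : Type*} (s : Multiset ι) (f g : ι → ℝ) (hf : ∀ a ∈ s, 0 ≤ f a)
    (h : ∀ a ∈ s, f a ≤ g a) : (s.map f).prod ≤ (s.map g).prod := by
  induction s using Multiset.induction with
  | empty => simp
  | cons a s ih =>
    simp only [Multiset.map_cons, Multiset.prod_cons]
    have h1 := h a (by simp)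
    have h2 := hf a (by simp)
    refine mul_le_mul h1 (ih (fun b hb => hf b (by simp [hb])) fun b hb => h b (by simp [hb]))
      (Multiset.prod_nonneg fun x hx => ?_) (h2.trans h1)
    obtain ⟨b, hb, rfl⟩ := Multiset.mem_map.1 hx
    exact hf b (by simp [hb])

/-! ### Gauss norms and root counts of polynomials on discs -/

section GaussNorm

variable {K : Type*} [NormedField K]

/-- The Gauss norm of `p` on the closed disc of centre `b` and radius `t`, computed from the
roots of `p`; this is the value for split polynomials. -/
def gaussAt (p : K[X]) (b : K) (t : ℝ) : ℝ :=
  ‖p.leadingCoeff‖ * (p.roots.map fun α => max t ‖α - b‖).prod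

open Classical in
/-- The number of roots of `p` in the set `s`, counted with multiplicity. -/
def rootsIn (p : K[X]) (s : Set K) : ℕ := (p.roots.filter (· ∈ s)).card

/-- All weighted coefficients of `p` at radius `t` are bounded by `g`, strictly so in degrees
larger than `n`. -/
def IsDominated (p : K[X]) (n : ℕ) (t g : ℝ) : Prop :=
  (∀ i, ‖p.coeff i‖ * t ^ i ≤ g) ∧ ∀ i, n < i → ‖p.coeff i‖ * t ^ i < g

/-- The Wronskian `p' q - p q'`, the numerator of the derivative of `p / q`. -/
def wronsk (p q : K[X]) : K[X] := derivative p * q - p * derivative q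

lemma gaussAt_nonneg (p : K[X]) (b : K) {t : ℝ} (ht : 0 ≤ t) : 0 ≤ gaussAt p b t := by
  refine mul_nonneg (norm_nonneg _) (Multiset.prod_nonneg fun x hx => ?_)
  obtain ⟨α, -, rfl⟩ := Multiset.mem_map.1 hx
  exact le_max_of_le_left ht

lemma gaussAt_pos {p : K[X]} (hp : p ≠ 0) (b : K) {t : ℝ} (ht : 0 < t) : 0 < gaussAt p b t := by
  refine mul_pos (norm_pos_iff.2 (leadingCoeff_ne_zero.2 hp)) (Multiset.prod_pos fun x hx => ?_)
  obtain ⟨α, -, rfl⟩ := Multiset.mem_map.1 hx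
  exact lt_max_of_lt_left ht

lemma gaussAt_zero (b : K) (t : ℝ) : gaussAt (0 : K[X]) b t = 0 := by simp [gaussAt]

lemma gaussAt_mul (p q : K[X]) (b : K) (t : ℝ) :
    gaussAt (p * q) b t = gaussAt p b t * gaussAt q b t := by
  rcases eq_or_ne p 0 with rfl | hp
  · simp [gaussAt_zero]
  rcases eq_or_ne q 0 with rfl | hq
  · simp [gaussAt_zero]
  simp only [gaussAt, leadingCoeff_mul, norm_mul, roots_mul (mul_ne_zero hp hq),
    Multiset.map_add, Multiset.prod_add]
  ring

lemma gaussAt_C (a b : K) (t : ℝ) : gaussAt (C a) b t = ‖a‖ := by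
  rw [gaussAt, leadingCoeff_C, roots_C]
  simp

lemma gaussAt_X (t : ℝ) (ht : 0 ≤ t) : gaussAt (X : K[X]) 0 t = t := by
  simp [gaussAt, ht]

lemma gaussAt_pow (p : K[X]) (b : K) (t : ℝ) (n : ℕ) :
    gaussAt (p ^ n) b t = gaussAt p b t ^ n := by
  induction n with
  | zero => simp [gaussAt]
  | succ n ih => rw [pow_succ, gaussAt_mul, ih, pow_succ]

lemma rootsIn_mul {p q : K[X]} (hp : p ≠ 0) (hq : q ≠ 0) (s : Set K) :
    rootsIn (p * q) s = rootsIn p s + rootsIn q s := by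
  unfold rootsIn
  rw [roots_mul (mul_ne_zero hp hq), Multiset.filter_add, Multiset.card_add]

lemma rootsIn_pow {p : K[X]} (hp : p ≠ 0) (s : Set K) (n : ℕ) :
    rootsIn (p ^ n) s = n * rootsIn p s := by
  induction n with
  | zero => rw [pow_zero, zero_mul, rootsIn, roots_one]; rfl
  | succ n ih => rw [pow_succ, rootsIn_mul (pow_ne_zero _ hp) hp, ih, add_mul, one_mul]

lemma rootsIn_le_natDegree (p : K[X]) (s : Set K) : rootsIn p s ≤ p.natDegree :=
  (Multiset.card_le_card (@Multiset.filter_le _ _ (Classical.decPred _) _)).trans (card_roots' p)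

lemma continuous_gaussAt (p : K[X]) (b : K) : Continuous (gaussAt p b) := by
  refine continuous_const.mul ?_
  induction p.roots using Multiset.induction with
  | empty => simpa using continuous_const
  | cons a s ih =>
    simp only [Multiset.map_cons, Multiset.prod_cons]
    exact (continuous_id.max continuous_const).mul ih

lemma gaussAt_mono (p : K[X]) (b : K) {s t : ℝ} (hs : 0 ≤ s) (hst : s ≤ t) :
    gaussAt p b s ≤ gaussAt p b t :=
  mul_le_mul_of_nonneg_left (prod_map_le_prod_map_of_nonneg _ _ _
    (fun _ _ => le_max_of_le_left hs) fun _ _ => max_le_max_right _ hst) (norm_nonneg _)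

/-- The Gauss norm over an interval of radii free of roots is a monomial. -/
lemma gaussAt_eq_of_no_roots (p : K[X]) (b : K) {s t : ℝ} (hs : 0 < s) (hst : s ≤ t)
    (h : ∀ α ∈ p.roots, ‖α - b‖ ≤ s ∨ t ≤ ‖α - b‖) :
    gaussAt p b t = gaussAt p b s * (t / s) ^ rootsIn p (closedBall b s) := by
  classical
  unfold gaussAt rootsIn
  rw [mul_assoc]
  congr 1
  revert h
  induction p.roots using Multiset.induction with
  | empty => simp
  | cons a m ih =>
    intro h
    have ih := ih fun α hα => h α (by simp [hα])
    simp only [Multiset.map_cons, Multiset.prod_cons, ih]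
    by_cases ha : a ∈ closedBall b s
    · rw [Multiset.filter_cons_of_pos _ ha, Multiset.card_cons, pow_succ]
      rw [mem_closedBall, dist_eq_norm] at ha
      rw [max_eq_left ha, max_eq_left (ha.trans hst)]
      field_simp
    · rw [Multiset.filter_cons_of_neg _ ha]
      rw [mem_closedBall, dist_eq_norm] at ha
      have := (h a (by simp)).resolve_left ha
      rw [max_eq_right this, max_eq_right (hst.trans this), mul_assoc]

lemma rootsIn_ball_eq_of_no_roots (p : K[X]) (b : K) {s t : ℝ} (hst : s < t)
    (h : ∀ α ∈ p.roots, ‖α - b‖ ≤ s ∨ t ≤ ‖α - b‖) :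
    rootsIn p (ball b t) = rootsIn p (closedBall b s) := by
  classical
  unfold rootsIn
  congr 1
  refine Multiset.filter_congr fun α hα => ?_
  rw [mem_ball, mem_closedBall, dist_eq_norm]
  rcases h α hα with h | h
  · exact ⟨fun _ => h, fun _ => h.trans_lt hst⟩
  · exact ⟨fun h' => absurd h' (not_lt.2 h), fun h' => absurd (h.trans h') (not_le.2 hst)⟩

lemma gaussAt_le_of_le (p : K[X]) (b : K) {s t : ℝ} (hs : 0 < s) (hst : s ≤ t) :
    gaussAt p b t ≤ gaussAt p b s * (t / s) ^ p.natDegree := by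
  have h1 : 1 ≤ t / s := (one_le_div hs).2 hst
  have key : (p.roots.map fun α => max t ‖α - b‖).prod ≤
      (p.roots.map fun α => max s ‖α - b‖).prod * (t / s) ^ p.roots.card := by
    have := prod_map_le_prod_map_of_nonneg p.roots (fun α => max t ‖α - b‖)
      (fun α => max s ‖α - b‖ * (t / s)) (fun _ _ => le_max_of_le_left (hs.le.trans hst))
      (fun α _ => by
        refine max_le ?_ ?_
        · calc t = s * (t / s) := by field_simp
            _ ≤ _ := mul_le_mul_of_nonneg_right (le_max_left _ _) (by positivity)
        · calc ‖α - b‖ ≤ ‖α - b‖ * (t / s) := le_mul_of_one_le_right (norm_nonneg _) h1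
            _ ≤ _ := mul_le_mul_of_nonneg_right (le_max_right _ _) (by positivity))
    simpa [Multiset.prod_map_mul] using this
  unfold gaussAt
  rw [mul_assoc]
  refine mul_le_mul_of_nonneg_left (key.trans ?_) (norm_nonneg _)
  refine mul_le_mul_of_nonneg_left (pow_le_pow_right₀ h1 (card_roots' p)) ?_
  refine Multiset.prod_nonneg fun x hx => ?_
  obtain ⟨α, -, rfl⟩ := Multiset.mem_map.1 hx
  exact le_max_of_le_left hs.le

lemma taylor_derivative (p : K[X]) (b : K) :
    taylor b (derivative p) = derivative (taylor b p) := by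
  simp [taylor_apply, derivative_comp]

lemma norm_eval_eq_prod [IsAlgClosed K] (p : K[X]) (z : K) :
    ‖p.eval z‖ = ‖p.leadingCoeff‖ * (p.roots.map fun α => ‖α - z‖).prod := by
  conv_lhs => rw [(IsAlgClosed.splits p).eq_prod_roots]
  rw [eval_mul, eval_C, norm_mul, eval_multiset_prod]
  congr 1
  induction p.roots using Multiset.induction with
  | empty => simp
  | cons a s ih =>
    simp only [Multiset.map_cons, Multiset.prod_cons, norm_mul, ih]
    simp [norm_sub_rev z a]

/-- When no root is closer to `z` than `t`, each factor `max t ‖α - z‖` is the distance itself. -/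
lemma norm_eval_eq_gaussAt [IsAlgClosed K] (p : K[X]) (z : K) {t : ℝ} (h : ∀ α ∈ p.roots, t ≤ ‖α - z‖) :
    ‖p.eval z‖ = gaussAt p z t := by
  rw [norm_eval_eq_prod, gaussAt]
  congr 2
  exact Multiset.map_congr rfl fun α hα => (max_eq_right (h α hα)).symm

/-! ### Ultrametric estimates: Newton polygons and derivatives -/

section Ultrametric

variable [IsUltrametricDist K]

lemma norm_sub_le_max_norm (x y : K) : ‖x - y‖ ≤ max ‖x‖ ‖y‖ := by
  simpa [sub_eq_add_neg] using IsUltrametricDist.norm_add_le_max x (-y)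

/-- Every point of an ultrametric disc is a centre. This glues the families of discs around
different centres once the radius reaches the distance of the centres. -/
lemma gaussAt_center (p : K[X]) {b c : K} {t : ℝ} (h : ‖b - c‖ ≤ t) :
    gaussAt p b t = gaussAt p c t := by
  unfold gaussAt
  congr 2
  refine Multiset.map_congr rfl fun α _ => ?_
  have h1 : ‖α - c‖ ≤ max ‖α - b‖ ‖b - c‖ := by
    simpa using IsUltrametricDist.norm_add_le_max (α - b) (b - c)
  have h2 : ‖α - b‖ ≤ max ‖α - c‖ ‖b - c‖ := by
    simpa using norm_sub_le_max_norm (α - c) (b - c)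
  refine le_antisymm (max_le (le_max_left _ _) (h2.trans (max_le (le_max_right _ _) ?_)))
    (max_le (le_max_left _ _) (h1.trans (max_le (le_max_right _ _) ?_))) <;>
  exact h.trans (le_max_left _ _)

lemma norm_sum_lt_of_forall_lt {ι : Type*} (s : Finset ι) (f : ι → K) {c : ℝ} (hc : 0 < c)
    (h : ∀ i ∈ s, ‖f i‖ < c) : ‖∑ i ∈ s, f i‖ < c := by
  classical
  induction s using Finset.induction with
  | empty => simpa
  | insert a s ha ih =>
    rw [Finset.sum_insert ha]
    exact (IsUltrametricDist.norm_add_le_max _ _).trans_lt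
      (max_lt (h a (by simp)) (ih fun i hi => h i (by simp [hi])))

lemma norm_eq_of_norm_sub_lt {x y : K} (h : ‖x - y‖ < ‖y‖) : ‖x‖ = ‖y‖ := by
  have h1 : ‖x‖ ≤ max ‖x - y‖ ‖y‖ := by
    simpa using IsUltrametricDist.norm_add_le_max (x - y) y
  have h2 : ‖y‖ ≤ max ‖x‖ ‖x - y‖ := by
    simpa using norm_sub_le_max_norm x (x - y)
  refine le_antisymm (h1.trans (max_le h.le le_rfl)) ?_
  rcases le_max_iff.1 h2 with h2 | h2
  · exact h2
  · exact absurd h2 (not_le.2 h)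

/-- In degree `n + m` every index pair other than `(n, m)` has `i > n` or `j > m`, so its term is
strictly smaller: the last dominant index is additive. -/
lemma IsDominated.mul {p q : K[X]} {n m : ℕ} {t g h : ℝ} (ht : 0 < t) (hg : 0 < g) (hh : 0 < h)
    (hp : IsDominated p n t g) (hq : IsDominated q m t h) :
    IsDominated (p * q) (n + m) t (g * h) ∧
      ‖(p * q).coeff (n + m) - p.coeff n * q.coeff m‖ * t ^ (n + m) < g * h := by
  have term : ∀ i j : ℕ, ‖p.coeff i * q.coeff j‖ * t ^ (i + j) =
      (‖p.coeff i‖ * t ^ i) * (‖q.coeff j‖ * t ^ j) := fun i j => by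
    rw [norm_mul, pow_add]; ring
  have nn : ∀ (r : K[X]) (i : ℕ), 0 ≤ ‖r.coeff i‖ * t ^ i := fun r i => by positivity
  have le : ∀ i j : ℕ, ‖p.coeff i * q.coeff j‖ * t ^ (i + j) ≤ g * h := fun i j => by
    rw [term]
    exact mul_le_mul (hp.1 i) (hq.1 j) (nn _ _) hg.le
  have lt : ∀ i j : ℕ, n < i ∨ m < j → ‖p.coeff i * q.coeff j‖ * t ^ (i + j) < g * h := by
    intro i j hij
    rw [term]
    rcases hij with hi | hj
    · exact (mul_le_mul_of_nonneg_left (hq.1 j) (nn _ _)).trans_lt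
        (mul_lt_mul_of_pos_right (hp.2 i hi) hh)
    · exact (mul_le_mul_of_nonneg_right (hp.1 i) (nn _ _)).trans_lt
        (mul_lt_mul_of_pos_left (hq.2 j hj) hg)
  refine ⟨⟨fun i => ?_, fun i hi => ?_⟩, ?_⟩
  · rw [← le_div_iff₀ (by positivity), coeff_mul]
    refine IsUltrametricDist.norm_sum_le_of_forall_le_of_nonneg (by positivity) fun x hx => ?_
    rw [le_div_iff₀ (by positivity), ← Finset.HasAntidiagonal.mem_antidiagonal.1 hx]
    exact le _ _
  · rw [← lt_div_iff₀ (by positivity), coeff_mul]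
    refine norm_sum_lt_of_forall_lt _ _ (by positivity) fun x hx => ?_
    have := Finset.HasAntidiagonal.mem_antidiagonal.1 hx
    rw [lt_div_iff₀ (by positivity), ← this]
    exact lt _ _ (by omega)
  · rw [← lt_div_iff₀ (by positivity), coeff_mul,
      ← Finset.sum_erase_add _ _ (Finset.HasAntidiagonal.mem_antidiagonal.2 (rfl : (n, m).1 + (n, m).2 = n + m)),
      add_sub_cancel_right]
    refine norm_sum_lt_of_forall_lt _ _ (by positivity) fun x hx => ?_
    obtain ⟨hne, hx⟩ := Finset.mem_erase.1 hx
    have := Finset.HasAntidiagonal.mem_antidiagonal.1 hx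
    rw [lt_div_iff₀ (by positivity), ← this]
    refine lt _ _ ?_
    by_contra! hcon
    exact hne (Prod.ext (by simp; omega) (by simp; omega))

lemma IsDominated.mul_attained {p q : K[X]} {n m : ℕ} {t g h : ℝ} (ht : 0 < t) (hg : 0 < g)
    (hh : 0 < h) (hp : IsDominated p n t g) (hq : IsDominated q m t h)
    (hp' : ‖p.coeff n‖ * t ^ n = g) (hq' : ‖q.coeff m‖ * t ^ m = h) :
    ‖(p * q).coeff (n + m)‖ * t ^ (n + m) = g * h := by
  have h1 := (hp.mul ht hg hh hq).2
  have h2 : ‖p.coeff n * q.coeff m‖ * t ^ (n + m) = g * h := by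
    rw [norm_mul, pow_add, ← hp', ← hq']; ring
  rw [← h2] at h1 ⊢
  rw [norm_eq_of_norm_sub_lt (lt_of_mul_lt_mul_right h1 (by positivity))]

/-- Induction on the linear factors: the last dominant index of `X - (a - b)` is 1 if `a` lies in
the closed disc and 0 otherwise, and these indices add up. -/
lemma isDominated_taylor_prod (s : Multiset K) (b : K) {t : ℝ} (ht : 0 < t) :
    ∃ n : ℕ, (∀ [DecidablePred (· ∈ closedBall b t)],
        n = (s.filter (· ∈ closedBall b t)).card) ∧
      IsDominated (taylor b (s.map fun α => X - C α).prod) n t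
        (s.map fun α => max t ‖α - b‖).prod ∧
      ‖(taylor b (s.map fun α => X - C α).prod).coeff n‖ * t ^ n =
        (s.map fun α => max t ‖α - b‖).prod := by
  classical
  induction s using Multiset.induction with
  | empty =>
    refine ⟨0, by simp, ⟨fun i => ?_, fun i hi => ?_⟩, by simp⟩
    · rcases i with _ | i
      · simp
      · simp [coeff_one]
    · simp [coeff_one, hi.ne']
  | cons a s ih =>
    obtain ⟨n, hn, hd, he⟩ := ih
    have hpos : 0 < (s.map fun α => max t ‖α - b‖).prod := Multiset.prod_pos fun x hx => by
      obtain ⟨α, -, rfl⟩ := Multiset.mem_map.1 hx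
      exact lt_max_of_lt_left ht
    simp only [Multiset.map_cons, Multiset.prod_cons, taylor_mul]
    have hlin : taylor b (X - C a) = X - C (a - b) := by
      simp [C_sub]; ring
    have hco : ∀ i, 1 < i → (X - C (a - b)).coeff i = 0 := fun i hi => by
      rw [coeff_sub, coeff_X, coeff_C, if_neg (by omega), if_neg (by omega), sub_zero]
    have hco0 : (X - C (a - b)).coeff 0 = -(a - b) := by simp
    have hco1 : (X - C (a - b)).coeff 1 = 1 := by simp [coeff_X]
    have hmpos : 0 < max t ‖a - b‖ := lt_max_of_lt_left ht
    obtain ⟨k, hk, hd', he'⟩ : ∃ k : ℕ, (k = if a ∈ closedBall b t then 1 else 0) ∧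
        IsDominated (X - C (a - b)) k t (max t ‖a - b‖) ∧
        ‖(X - C (a - b)).coeff k‖ * t ^ k = max t ‖a - b‖ := by
      by_cases ha : a ∈ closedBall b t
      · refine ⟨1, by simp [ha], ⟨fun i => ?_, fun i hi => ?_⟩, ?_⟩
        · rcases i with _ | _ | i
          · rw [hco0, norm_neg]; simp
          · rw [hco1]; simp
          · rw [hco _ (by omega)]; simp
        · rw [hco _ hi]; simpa using hmpos
        · rw [mem_closedBall, dist_eq_norm] at ha
          rw [hco1, max_eq_left ha]; simp
      · refine ⟨0, by simp [ha], ?_⟩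
        rw [mem_closedBall, dist_eq_norm, not_le] at ha
        refine ⟨⟨fun i => ?_, fun i hi => ?_⟩, ?_⟩
        · rcases i with _ | _ | i
          · rw [hco0, norm_neg]; simp
          · rw [hco1]; simp
          · rw [hco _ (by omega)]; simp
        · rcases i with _ | _ | i
          · omega
          · rw [hco1]; simpa using ha
          · rw [hco _ (by omega)]; simpa using hmpos
        · rw [hco0, norm_neg, max_eq_right ha.le]; simp
    rw [hlin]
    refine ⟨k + n, fun {_} => ?_, (hd'.mul ht hmpos hpos hd).1,
      hd'.mul_attained ht hmpos hpos hd he' he⟩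
    rw [hn]
    by_cases ha : a ∈ closedBall b t
    · rw [Multiset.filter_cons_of_pos _ ha, Multiset.card_cons, hk, if_pos ha, add_comm]
    · rw [Multiset.filter_cons_of_neg _ ha, hk, if_neg ha, zero_add]

section AlgClosed

variable [IsAlgClosed K]

/-- The Newton polygon: the Gauss norm, defined by roots and hence multiplicative, is also the
largest weighted coefficient, and the last index attaining it is the root count. This second
description gives access to sums and derivatives. -/
lemma taylor_isDominated (p : K[X]) (hp : p ≠ 0) (b : K) {t : ℝ} (ht : 0 < t) :
    IsDominated (taylor b p) (rootsIn p (closedBall b t)) t (gaussAt p b t) ∧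
      ‖(taylor b p).coeff (rootsIn p (closedBall b t))‖ * t ^ rootsIn p (closedBall b t) =
        gaussAt p b t := by
  classical
  obtain ⟨n, hn, hd, he⟩ := isDominated_taylor_prod p.roots b ht
  have hlc : 0 < ‖p.leadingCoeff‖ := norm_pos_iff.2 (leadingCoeff_ne_zero.2 hp)
  have hco : ∀ i, ‖(taylor b p).coeff i‖ = ‖p.leadingCoeff‖ *
      ‖(taylor b (p.roots.map fun α => X - C α).prod).coeff i‖ := fun i => by
    conv_lhs => rw [(IsAlgClosed.splits p).eq_prod_roots]
    rw [taylor_mul, taylor_C, coeff_C_mul, norm_mul]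
  have hn' : rootsIn p (closedBall b t) = n := by
    rw [hn]; rfl
  rw [hn']
  refine ⟨⟨fun i => ?_, fun i hi => ?_⟩, ?_⟩
  · rw [hco, mul_assoc]
    exact mul_le_mul_of_nonneg_left (hd.1 i) hlc.le
  · rw [hco, mul_assoc]
    exact mul_lt_mul_of_pos_left (hd.2 i hi) hlc
  · rw [hco, mul_assoc, he]; rfl

lemma norm_coeff_taylor_le (p : K[X]) (b : K) {t : ℝ} (ht : 0 < t) (i : ℕ) :
    ‖(taylor b p).coeff i‖ * t ^ i ≤ gaussAt p b t := by
  rcases eq_or_ne p 0 with rfl | hp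
  · simp [gaussAt_zero]
  · exact (taylor_isDominated p hp b ht).1.1 i

lemma gaussAt_le (p : K[X]) (b : K) {t c : ℝ} (ht : 0 < t) (hc : 0 ≤ c)
    (h : ∀ i, ‖(taylor b p).coeff i‖ * t ^ i ≤ c) : gaussAt p b t ≤ c := by
  rcases eq_or_ne p 0 with rfl | hp
  · simpa [gaussAt_zero]
  · rw [← (taylor_isDominated p hp b ht).2]
    exact h _

lemma gaussAt_sub_le (p q : K[X]) (b : K) {t : ℝ} (ht : 0 < t) :
    gaussAt (p - q) b t ≤ max (gaussAt p b t) (gaussAt q b t) := by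
  refine gaussAt_le _ _ ht (le_max_of_le_left (gaussAt_nonneg _ _ ht.le)) fun i => ?_
  rw [map_sub, coeff_sub]
  have : (0 : ℝ) < t ^ i := by positivity
  refine (mul_le_mul_of_nonneg_right (norm_sub_le_max_norm _ _) this.le).trans ?_
  rw [max_mul_of_nonneg _ _ this.le]
  exact max_le_max (norm_coeff_taylor_le _ _ ht _) (norm_coeff_taylor_le _ _ ht _)

lemma gaussAt_derivative_le (p : K[X]) (b : K) {t : ℝ} (ht : 0 < t) :
    t * gaussAt (derivative p) b t ≤ gaussAt p b t := by
  rw [← le_div_iff₀' ht]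
  refine gaussAt_le _ _ ht (div_nonneg (gaussAt_nonneg _ _ ht.le) ht.le) fun i => ?_
  rw [taylor_derivative, coeff_derivative, le_div_iff₀ ht, norm_mul, mul_assoc, ← pow_succ]
  refine le_trans ?_ (norm_coeff_taylor_le p b ht (i + 1))
  have : ‖((i : K) + 1)‖ ≤ 1 := by exact_mod_cast IsUltrametricDist.norm_natCast_le_one K (i + 1)
  exact mul_le_mul_of_nonneg_right (mul_le_of_le_one_right (norm_nonneg _) this) (by positivity)

/-- Differentiation multiplies the dominant coefficient, whose index is the root count, by that
index. -/
lemma le_gaussAt_derivative (p : K[X]) (b : K) {t : ℝ} (ht : 0 < t) :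
    ‖(rootsIn p (closedBall b t) : K)‖ * gaussAt p b t ≤ t * gaussAt (derivative p) b t := by
  rcases eq_or_ne p 0 with rfl | hp
  · simp [gaussAt_zero]
  rw [← (taylor_isDominated p hp b ht).2]
  rcases rootsIn p (closedBall b t) with _ | n
  · simpa using mul_nonneg ht.le (gaussAt_nonneg _ _ ht.le)
  · have := norm_coeff_taylor_le (derivative p) b ht n
    rw [taylor_derivative, coeff_derivative, norm_mul] at this
    have h2 := mul_le_mul_of_nonneg_left this ht.le
    refine le_trans (le_of_eq ?_) h2
    push_cast
    ring

lemma norm_eval_le_gaussAt (p : K[X]) (b : K) {t : ℝ} (ht : 0 < t) :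
    ‖p.eval b‖ ≤ gaussAt p b t := by
  simpa using norm_coeff_taylor_le p b ht 0

lemma gaussAt_wronsk_le {p q : K[X]} (b : K) {t : ℝ} (ht : 0 < t) :
    t * gaussAt (wronsk p q) b t ≤ gaussAt p b t * gaussAt q b t := by
  refine (mul_le_mul_of_nonneg_left (gaussAt_sub_le _ _ b ht) ht.le).trans ?_
  rw [mul_max_of_nonneg _ _ ht.le]
  refine max_le ?_ ?_
  · rw [gaussAt_mul, ← mul_assoc]
    exact mul_le_mul_of_nonneg_right (gaussAt_derivative_le p b ht) (gaussAt_nonneg _ _ ht.le)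
  · rw [gaussAt_mul, mul_left_comm]
    exact mul_le_mul_of_nonneg_left (gaussAt_derivative_le q b ht) (gaussAt_nonneg _ _ ht.le)

end AlgClosed

end Ultrametric

end GaussNorm

/-! ### Slopes of quotients of Gauss norms, and the logarithmic derivative -/

section Slopes

/-- Induction on the number of break points strictly inside the interval, cutting at one of them. -/
lemma rel_of_local {r : ℝ → ℝ → Prop} (hrefl : ∀ a, r a a) (htrans : ∀ a b c, r a b → r b c → r a c)
    (S : Finset ℝ) {a b : ℝ} (hab : a ≤ b)
    (h : ∀ s t, a ≤ s → s < t → t ≤ b → (∀ x ∈ S, x ≤ s ∨ t ≤ x) → r s t) : r a b := by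
  induction hn : (S.filter fun x => a < x ∧ x < b).card using Nat.strong_induction_on
    generalizing a b with
  | _ n ih =>
    rcases hab.eq_or_lt with rfl | hlt
    · exact hrefl a
    by_cases hS : ∃ x ∈ S, a < x ∧ x < b
    · obtain ⟨x, hx, hax, hxb⟩ := hS
      have hmem : x ∈ S.filter fun x => a < x ∧ x < b := by simp [hx, hax, hxb]
      refine htrans _ x _ (ih _ ?_ hax.le (fun s t h1 h2 h3 => h s t h1 h2 (h3.trans hxb.le)) rfl)
        (ih _ ?_ hxb.le (fun s t h1 h2 h3 => h s t (hax.le.trans h1) h2 h3) rfl)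
      · rw [← hn]
        refine Finset.card_lt_card ((Finset.ssubset_iff_of_subset fun y hy => ?_).2
          ⟨x, hmem, by simp⟩)
        simp only [Finset.mem_filter] at hy ⊢
        exact ⟨hy.1, hy.2.1, hy.2.2.trans hxb⟩
      · rw [← hn]
        refine Finset.card_lt_card ((Finset.ssubset_iff_of_subset fun y hy => ?_).2
          ⟨x, hmem, by simp⟩)
        simp only [Finset.mem_filter] at hy ⊢
        exact ⟨hy.1, hax.trans hy.2.1, hy.2.2⟩
    · push Not at hS
      refine h a b le_rfl hlt le_rfl fun x hx => ?_
      by_cases hax : a < x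
      · exact Or.inr (hS x hx hax)
      · exact Or.inl (not_lt.1 hax)

variable {K : Type*} [NormedField K]

/-- If the slope of `|p / q|` is at most `-c` on an interval of radii, then `|p / q| t ^ c`
decreases there. -/
lemma gaussAt_ratio_le {p q : K[X]} (hq : q ≠ 0) (b : K) (c : ℕ) {t₀ t₁ : ℝ}
    (h₀ : 0 < t₀) (h₁ : t₀ ≤ t₁)
    (h : ∀ s t, t₀ ≤ s → s < t → t ≤ t₁ →
      rootsIn p (ball b t) = rootsIn p (closedBall b s) →
      rootsIn q (ball b t) = rootsIn q (closedBall b s) →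
      rootsIn p (closedBall b s) + c ≤ rootsIn q (closedBall b s)) :
    gaussAt p b t₁ * t₁ ^ c / gaussAt q b t₁ ≤ gaussAt p b t₀ * t₀ ^ c / gaussAt q b t₀ := by
  classical
  refine rel_of_local
    (r := fun s t => gaussAt p b t * t ^ c / gaussAt q b t ≤ gaussAt p b s * s ^ c / gaussAt q b s)
    (fun _ => le_rfl) (fun _ _ _ h1 h2 => h2.trans h1)
    ((p.roots + q.roots).toFinset.image fun α => ‖α - b‖) h₁ fun s t hs hst ht hS => ?_
  have hs0 : 0 < s := h₀.trans_le hs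
  have hp' : ∀ α ∈ p.roots, ‖α - b‖ ≤ s ∨ t ≤ ‖α - b‖ := fun α hα =>
    hS _ (Finset.mem_image_of_mem _ (by simp only [Multiset.mem_toFinset, Multiset.mem_add]; tauto))
  have hq' : ∀ α ∈ q.roots, ‖α - b‖ ≤ s ∨ t ≤ ‖α - b‖ := fun α hα =>
    hS _ (Finset.mem_image_of_mem _ (by simp only [Multiset.mem_toFinset, Multiset.mem_add]; tauto))
  have key := h s t hs hst ht (rootsIn_ball_eq_of_no_roots p b hst hp')
    (rootsIn_ball_eq_of_no_roots q b hst hq')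
  rw [gaussAt_eq_of_no_roots p b hs0 hst.le hp', gaussAt_eq_of_no_roots q b hs0 hst.le hq']
  have hx : 1 ≤ t / s := (one_le_div hs0).2 hst.le
  have hgq := gaussAt_pos hq b hs0
  have hgp := gaussAt_nonneg p b hs0.le
  have htx : t = s * (t / s) := by field_simp
  set x := t / s
  rw [htx, mul_pow, div_le_div_iff₀ (by positivity) hgq]
  have := pow_le_pow_right₀ hx key
  calc _ = gaussAt p b s * s ^ c * gaussAt q b s * x ^ (rootsIn p (closedBall b s) + c) := by
        rw [pow_add]; ring
    _ ≤ gaussAt p b s * s ^ c * gaussAt q b s * x ^ rootsIn q (closedBall b s) := by gcongr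
    _ = _ := by ring

lemma coeff_X_mul_derivative (p : K[X]) (i : ℕ) :
    (X * derivative p).coeff i = i * p.coeff i := by
  rcases i with _ | i
  · simp
  · rw [coeff_X_mul, coeff_derivative]; push_cast; ring

variable [IsUltrametricDist K]

lemma isDominated_X_mul_derivative {p : K[X]} {n : ℕ} {t g : ℝ} (ht : 0 ≤ t)
    (h : IsDominated p n t g) : IsDominated (X * derivative p) n t g := by
  have key : ∀ i, ‖(X * derivative p).coeff i‖ * t ^ i ≤ ‖p.coeff i‖ * t ^ i := fun i => by
    rw [coeff_X_mul_derivative, norm_mul]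
    exact mul_le_mul_of_nonneg_right (mul_le_of_le_one_left (norm_nonneg _)
      (IsUltrametricDist.norm_natCast_le_one K i)) (by positivity)
  exact ⟨fun i => (key i).trans (h.1 i), fun i hi => (key i).trans_lt (h.2 i hi)⟩

variable [IsAlgClosed K]

/-- The coefficient of degree `n + m` in `X * W` is `(n - m) u v`, where `u` and `v` are the
dominant coefficients, up to an error strictly below the product of the Gauss norms. If `|n - m| =
1`, the main term has exactly that size and wins; for smaller `|n - m|` the error could hide it. -/
lemma le_gaussAt_wronsk_of_norm_eq_one {p q : K[X]} (hp : p ≠ 0) (hq : q ≠ 0) (b : K) {t : ℝ}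
    (ht : 0 < t)
    (h : ‖(rootsIn p (closedBall b t) : K) - rootsIn q (closedBall b t)‖ = 1) :
    gaussAt p b t * gaussAt q b t ≤ t * gaussAt (wronsk p q) b t := by
  obtain ⟨dp, ep⟩ := taylor_isDominated p hp b ht
  obtain ⟨dq, eq⟩ := taylor_isDominated q hq b ht
  set n := rootsIn p (closedBall b t)
  set m := rootsIn q (closedBall b t)
  have gp := gaussAt_pos hp b ht
  have gq := gaussAt_pos hq b ht
  have hA := ((isDominated_X_mul_derivative ht.le dp).mul ht gp gq dq).2
  have hB := (dp.mul ht gp gq (isDominated_X_mul_derivative ht.le dq)).2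
  have hW : X * taylor b (wronsk p q) = X * derivative (taylor b p) * taylor b q -
      taylor b p * (X * derivative (taylor b q)) := by
    rw [wronsk, map_sub, taylor_mul, taylor_mul, taylor_derivative, taylor_derivative]; ring
  have hle : ‖(X * taylor b (wronsk p q)).coeff (n + m)‖ * t ^ (n + m) ≤
      t * gaussAt (wronsk p q) b t := by
    rcases hnm : n + m with _ | k
    · simpa using mul_nonneg ht.le (gaussAt_nonneg _ _ ht.le)
    · rw [coeff_X_mul, pow_succ, ← mul_assoc, mul_comm]
      exact mul_le_mul_of_nonneg_left (norm_coeff_taylor_le _ _ ht _) ht.le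
  refine le_trans (le_of_eq ?_) hle
  have hmain : ‖((n : K) - m) * ((taylor b p).coeff n * (taylor b q).coeff m)‖ * t ^ (n + m) =
      gaussAt p b t * gaussAt q b t := by
    rw [norm_mul, h, norm_mul, ← ep, ← eq, pow_add]; ring
  rw [← hmain]
  congr 1
  refine (norm_eq_of_norm_sub_lt ?_).symm
  refine lt_of_mul_lt_mul_right (a := t ^ (n + m)) ?_ (by positivity)
  rw [hmain, hW, coeff_sub]
  rw [coeff_X_mul_derivative] at hA hB
  set x := (X * derivative (taylor b p) * taylor b q).coeff (n + m)
  set y := (taylor b p * (X * derivative (taylor b q))).coeff (n + m)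
  set u := (taylor b p).coeff n
  set v := (taylor b q).coeff m
  rw [show x - y - ((n : K) - m) * (u * v) = (x - n * u * v) - (y - u * (m * v)) by ring]
  refine (mul_le_mul_of_nonneg_right (norm_sub_le_max_norm _ _) (by positivity)).trans_lt ?_
  rw [max_mul_of_nonneg _ _ (by positivity)]
  exact max_lt hA hB

/-- At every radius the logarithmic derivative of `p / q` is at least the slope of `|p / q|`,
measured in `K`. -/
lemma le_gaussAt_wronsk {p q : K[X]} (hp : p ≠ 0) (hq : q ≠ 0) (b : K) {t : ℝ} (ht : 0 < t) :
    ‖(rootsIn p (closedBall b t) : K) - rootsIn q (closedBall b t)‖ *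
      (gaussAt p b t * gaussAt q b t) ≤ t * gaussAt (wronsk p q) b t := by
  have gp := gaussAt_pos hp b ht
  have gq := gaussAt_pos hq b ht
  have gW := gaussAt_nonneg (wronsk p q) b ht.le
  have hone := le_gaussAt_wronsk_of_norm_eq_one hp hq b ht
  have hRroots : ∀ M : ℕ, rootsIn (p * q ^ M) (closedBall b t) =
      rootsIn p (closedBall b t) + M * rootsIn q (closedBall b t) := fun M => by
    rw [rootsIn_mul hp (pow_ne_zero _ hq), rootsIn_pow hq]
  set n := rootsIn p (closedBall b t)
  set m := rootsIn q (closedBall b t)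
  set k : K := (n : K) - m with hk
  have hk1 : ‖k‖ ≤ 1 := (norm_sub_le_max_norm _ _).trans
    (max_le (IsUltrametricDist.norm_natCast_le_one K n) (IsUltrametricDist.norm_natCast_le_one K m))
  rcases eq_or_ne k 0 with h0 | h0
  · rw [h0, norm_zero, zero_mul]; positivity
  rcases hk1.eq_or_lt with h1 | h1
  · rw [h1, one_mul]
    exact hone h1
  have hkpos : 0 < ‖k‖ := norm_pos_iff.2 h0
  -- For `0 < |k| < 1` the quotient `p / q` is imitated by the polynomial `p * q ^ M` with `M` close
  -- to `-1` in `K`; `M + 1 = (n - m) ^ 2` is close enough.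
  have hM : ∃ M : ℕ, ‖((M + 1 : ℕ) : K)‖ < ‖k‖ := by
    have hnat : ‖((((n : ℤ) - m).natAbs : ℕ) : K)‖ = ‖k‖ := by
      have : k = (((n : ℤ) - m : ℤ) : K) := by rw [hk]; push_cast; ring
      rw [this]
      rcases Int.natAbs_eq ((n : ℤ) - m) with h | h
      · conv_rhs => rw [h]
        rw [Int.cast_natCast]
      · conv_rhs => rw [h]
        rw [Int.cast_neg, Int.cast_natCast, norm_neg]
    obtain ⟨M, hM⟩ := Nat.exists_eq_succ_of_ne_zero
      (n := ((n : ℤ) - m).natAbs ^ 2) (by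
        refine pow_ne_zero _ fun h => ?_
        rw [h, Nat.cast_zero, norm_zero] at hnat
        exact hkpos.ne hnat)
    refine ⟨M, ?_⟩
    rw [← Nat.succ_eq_add_one, ← hM, Nat.cast_pow, norm_pow, hnat, sq]
    exact mul_lt_of_lt_one_left hkpos h1
  obtain ⟨M, hM⟩ := hM
  set T : K[X] := C (-((M + 1 : ℕ) : K)) * (p * derivative q) with hT
  -- The derivative of `p * q ^ M` involves `p' q + M p q'`, which is the Wronskian up to the
  -- multiple `(M + 1) p q'`. That error is too small to account for the lower bound given by
  -- `le_gaussAt_derivative`, so the Wronskian must.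
  have hid : q * derivative (p * q ^ M) = q ^ M * (wronsk p q - T) := by
    rw [hT, wronsk, derivative_mul, derivative_pow]
    rcases M with _ | M
    · simp; ring
    · simp only [C_neg, Nat.cast_add, Nat.cast_one, C_add, C_1, Nat.add_sub_cancel]
      ring
  have h2 := le_gaussAt_derivative (p * q ^ M) b ht
  have hid' := congrArg (fun f => gaussAt f b t) hid
  simp only [gaussAt_mul, gaussAt_pow] at hid' h2
  rw [hRroots] at h2
  have hgM : 0 < gaussAt q b t ^ M := by positivity
  have h3 : ‖k‖ * (gaussAt p b t * gaussAt q b t) ≤ t * gaussAt (wronsk p q - T) b t := by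
    have hnorm : ‖((n + M * m : ℕ) : K)‖ = ‖k‖ := by
      refine norm_eq_of_norm_sub_lt ?_
      rw [show ((n + M * m : ℕ) : K) - k = ((M + 1 : ℕ) : K) * m by rw [hk]; push_cast; ring,
        norm_mul]
      exact (mul_le_of_le_one_right (norm_nonneg _)
        (IsUltrametricDist.norm_natCast_le_one K m)).trans_lt hM
    rw [hnorm] at h2
    refine le_of_mul_le_mul_right (a := gaussAt q b t ^ M) ?_ hgM
    have := mul_le_mul_of_nonneg_right h2 gq.le
    calc _ = ‖k‖ * (gaussAt p b t * gaussAt q b t ^ M) * gaussAt q b t := by ring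
      _ ≤ _ := this
      _ = t * (gaussAt q b t * gaussAt (derivative (p * q ^ M)) b t) := by ring
      _ = _ := by rw [hid']; ring
  have h4 : t * gaussAt T b t < ‖k‖ * (gaussAt p b t * gaussAt q b t) := by
    rw [hT, gaussAt_mul, gaussAt_C, norm_neg, gaussAt_mul]
    have := gaussAt_derivative_le q b ht
    calc _ = ‖((M + 1 : ℕ) : K)‖ * (gaussAt p b t * (t * gaussAt (derivative q) b t)) := by ring
      _ ≤ ‖((M + 1 : ℕ) : K)‖ * (gaussAt p b t * gaussAt q b t) := by gcongr
      _ < _ := mul_lt_mul_of_pos_right hM (by positivity)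
  have h5 := h3.trans (mul_le_mul_of_nonneg_left (gaussAt_sub_le (wronsk p q) T b ht) ht.le)
  rw [mul_max_of_nonneg _ _ ht.le] at h5
  exact (le_max_iff.1 h5).resolve_right (not_le.2 h4)

end Slopes

/-! ### Normalized maps: a good disc around 0 and holes around the poles -/

section Normalized

variable {K : Type*} [NormedField K]

lemma eventually_left_no_mem (S : Finset ℝ) (e : ℝ) :
    ∀ᶠ s in 𝓝[<] e, ∀ x ∈ S, x ≤ s ∨ e ≤ x := by
  rw [Filter.eventually_all_finset]
  intro x _
  rcases le_or_gt e x with h | h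
  · exact Eventually.of_forall fun _ => Or.inr h
  · filter_upwards [Ioo_mem_nhdsLT h] with s hs using Or.inl hs.1.le

lemma eventually_right_no_mem (S : Finset ℝ) (e : ℝ) :
    ∀ᶠ t in 𝓝[>] e, ∀ x ∈ S, x ≤ e ∨ t ≤ x := by
  rw [Filter.eventually_all_finset]
  intro x _
  rcases le_or_gt x e with h | h
  · exact Eventually.of_forall fun _ => Or.inl h
  · filter_upwards [Ioo_mem_nhdsGT h] with s hs using Or.inr hs.2.le

lemma eventually_left_no_roots (p : K[X]) (b : K) (e : ℝ) :
    ∀ᶠ s in 𝓝[<] e, ∀ α ∈ p.roots, ‖α - b‖ ≤ s ∨ e ≤ ‖α - b‖ := by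
  classical
  filter_upwards [eventually_left_no_mem (p.roots.toFinset.image fun α => ‖α - b‖) e] with s hs α hα
  exact hs _ (Finset.mem_image_of_mem _ (Multiset.mem_toFinset.2 hα))

lemma eventually_right_no_roots (p : K[X]) (b : K) (e : ℝ) :
    ∀ᶠ t in 𝓝[>] e, ∀ α ∈ p.roots, ‖α - b‖ ≤ e ∨ t ≤ ‖α - b‖ := by
  classical
  filter_upwards [eventually_right_no_mem (p.roots.toFinset.image fun α => ‖α - b‖) e]
    with s hs α hα
  exact hs _ (Finset.mem_image_of_mem _ (Multiset.mem_toFinset.2 hα))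

/-- The exponent of `|p / q|` between the two radii is the difference of the root counts, here at
most 0. -/
lemma gaussAt_mul_le_of_rootsIn_le (p q : K[X]) (b : K) {s t : ℝ} (hs : 0 < s) (hst : s ≤ t)
    (hp : ∀ α ∈ p.roots, ‖α - b‖ ≤ s ∨ t ≤ ‖α - b‖)
    (hq : ∀ α ∈ q.roots, ‖α - b‖ ≤ s ∨ t ≤ ‖α - b‖)
    (h : rootsIn p (closedBall b s) ≤ rootsIn q (closedBall b s)) :
    gaussAt p b t * gaussAt q b s ≤ gaussAt p b s * gaussAt q b t := by
  rw [gaussAt_eq_of_no_roots p b hs hst hp, gaussAt_eq_of_no_roots q b hs hst hq]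
  have := pow_le_pow_right₀ ((one_le_div hs).2 hst) h
  have h1 := gaussAt_nonneg p b hs.le
  have h2 := gaussAt_nonneg q b hs.le
  calc _ = gaussAt p b s * gaussAt q b s * (t / s) ^ rootsIn p (closedBall b s) := by ring
    _ ≤ gaussAt p b s * gaussAt q b s * (t / s) ^ rootsIn q (closedBall b s) := by gcongr
    _ = _ := by ring

lemma le_gaussAt_of_splits [IsAlgClosed K] (p : K[X]) (b : K) {t : ℝ} (ht : 0 ≤ t) :
    ‖p.leadingCoeff‖ * t ^ p.natDegree ≤ gaussAt p b t := by
  have h := prod_map_le_prod_map_of_nonneg p.roots (fun _ => t) (fun α => max t ‖α - b‖)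
    (fun _ _ => ht) fun _ _ => le_max_left _ _
  rw [Multiset.map_const', Multiset.prod_replicate,
    ← (IsAlgClosed.splits p).natDegree_eq_card_roots] at h
  exact mul_le_mul_of_nonneg_left h (norm_nonneg _)

/-- A rational function `P / Q` of degree `d` with a simple zero at the fixed point `0` and a pole
at infinity; `r` is the smallest absolute value of the other zeros and poles, and the multiplier
at `0` is less than `μ ^ d`, where `μ` bounds the integers `1, …, d` from below. -/
structure IsNormalized (P Q : K[X]) (d : ℕ) (μ r : ℝ) : Prop where
  right_eval_ne : ∀ {a : K}, P.eval a = 0 → Q.eval a ≠ 0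
  natDegree_left : P.natDegree = d
  natDegree_right : Q.natDegree < d
  eval_zero : P.eval 0 = 0
  derivative_ne : P.derivative.eval 0 ≠ 0
  pos : 0 < μ
  le_norm : ∀ m : ℕ, 1 ≤ m → m ≤ d → μ ≤ ‖(m : K)‖
  lt : ‖P.derivative.eval 0‖ < μ ^ d * ‖Q.eval 0‖
  radius_pos : 0 < r
  le_left : ∀ α ∈ P.roots, α ≠ 0 → r ≤ ‖α‖
  le_right : ∀ α ∈ Q.roots, r ≤ ‖α‖
  exists_root : ∃ α, (α ∈ P.roots ∨ α ∈ Q.roots) ∧ ‖α‖ = r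

namespace IsNormalized

variable {P Q : K[X]} {d : ℕ} {μ r : ℝ}

lemma left_ne (N : IsNormalized P Q d μ r) : P ≠ 0 := by
  rintro rfl
  simpa using N.derivative_ne

lemma right_ne (N : IsNormalized P Q d μ r) : Q ≠ 0 := by
  rintro rfl
  exact N.right_eval_ne N.eval_zero (by simp)

lemma mul_ne (N : IsNormalized P Q d μ r) : P * Q ≠ 0 := mul_ne_zero N.left_ne N.right_ne

lemma wronsk_ne (N : IsNormalized P Q d μ r) : wronsk P Q ≠ 0 := by
  intro h
  have := congrArg (eval 0) h
  simp only [wronsk, eval_sub, eval_mul, N.eval_zero, zero_mul, sub_zero, Polynomial.eval_zero,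
    mul_eq_zero] at this
  exact this.elim N.derivative_ne (N.right_eval_ne N.eval_zero)

lemma le_one (N : IsNormalized P Q d μ r) : μ ≤ 1 := by
  simpa using N.le_norm 1 le_rfl (Nat.one_le_iff_ne_zero.2 (Nat.ne_zero_of_lt N.natDegree_right))

/-- Applied to the root counts of `P` and `Q`: where the slope of `|P / Q|` is not 0, its absolute
value in `K` is at least `μ`. -/
lemma le_norm_sub (N : IsNormalized P Q d μ r) {i j : ℕ} (hi : i ≤ d) (hj : j ≤ d) (hij : i ≠ j) :
    μ ≤ ‖(i : K) - j‖ := by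
  rcases lt_or_gt_of_ne hij with h | h
  · rw [norm_sub_rev, ← Nat.cast_sub h.le]
    exact N.le_norm _ (by omega) (by omega)
  · rw [← Nat.cast_sub h.le]
    exact N.le_norm _ (by omega) (by omega)

lemma rootsIn_left_le (N : IsNormalized P Q d μ r) (s : Set K) : rootsIn P s ≤ d :=
  (rootsIn_le_natDegree P s).trans N.natDegree_left.le

lemma rootsIn_right_le (N : IsNormalized P Q d μ r) (s : Set K) : rootsIn Q s ≤ d :=
  (rootsIn_le_natDegree Q s).trans N.natDegree_right.le

lemma exists_eq_X_mul (N : IsNormalized P Q d μ r) : ∃ P₁ : K[X], P = X * P₁ ∧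
    P₁.eval 0 = P.derivative.eval 0 ∧ ∀ α ∈ P₁.roots, r ≤ ‖α‖ := by
  obtain ⟨P₁, rfl⟩ := dvd_iff_isRoot.2 (show P.IsRoot 0 from N.eval_zero)
  rw [C_0, sub_zero] at N ⊢
  refine ⟨P₁, rfl, by simp, fun α hα => N.le_left α ?_ ?_⟩
  · rw [roots_mul N.left_ne]
    exact Multiset.mem_add.2 (Or.inr hα)
  · rintro rfl
    apply N.derivative_ne
    simpa using isRoot_of_mem_roots hα

variable [IsAlgClosed K]

lemma gaussAt_right (N : IsNormalized P Q d μ r) {t : ℝ} (ht : t ≤ r) :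
    gaussAt Q 0 t = ‖Q.eval 0‖ :=
  (norm_eval_eq_gaussAt Q 0 fun α hα => by
    rw [sub_zero]; exact ht.trans (N.le_right α hα)).symm

lemma gaussAt_left (N : IsNormalized P Q d μ r) {t : ℝ} (ht₀ : 0 ≤ t) (ht : t ≤ r) :
    gaussAt P 0 t = ‖P.derivative.eval 0‖ * t := by
  obtain ⟨P₁, hP, h0, hr⟩ := N.exists_eq_X_mul
  rw [← h0, norm_eval_eq_gaussAt P₁ 0 (t := t) fun α hα => by rw [sub_zero]; exact ht.trans (hr α hα),
    hP, gaussAt_mul, gaussAt_X t ht₀, mul_comm]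

lemma gaussAt_lt (N : IsNormalized P Q d μ r) {t : ℝ} (ht₀ : 0 < t) (ht : t ≤ r) :
    gaussAt P 0 t < r * gaussAt Q 0 t := by
  rw [N.gaussAt_left ht₀.le ht, N.gaussAt_right ht]
  have h1 : μ ^ d ≤ 1 := pow_le_one₀ N.pos.le N.le_one
  have h2 := norm_nonneg (Q.eval 0)
  calc _ < μ ^ d * ‖Q.eval 0‖ * t := mul_lt_mul_of_pos_right N.lt ht₀
    _ ≤ 1 * ‖Q.eval 0‖ * r := by gcongr
    _ = _ := by ring

/-- As `deg Q < deg P`, the quotient `|P / Q|` grows at least linearly for large radii. -/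
lemma exists_large_radius (N : IsNormalized P Q d μ r) :
    ∃ t, r ≤ t ∧ r * gaussAt Q 0 t ≤ gaussAt P 0 t := by
  have hr := N.radius_pos
  have hlc : 0 < ‖P.leadingCoeff‖ := norm_pos_iff.2 (leadingCoeff_ne_zero.2 N.left_ne)
  have hg := gaussAt_pos N.right_ne 0 hr
  obtain ⟨k, hk⟩ : ∃ k, d = Q.natDegree + 1 + k :=
    Nat.exists_eq_add_of_le N.natDegree_right
  -- Chosen so that the upper bound for `r |Q|` equals the lower bound for `|P|` with one factor `t`
  -- replaced by `c`.
  set c := r * gaussAt Q 0 r / (r ^ Q.natDegree * (‖P.leadingCoeff‖ * r ^ k)) with hc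
  refine ⟨max r c, le_max_left _ _, ?_⟩
  set t := max r c
  have ht : r ≤ t := le_max_left _ _
  have h1 := gaussAt_le_of_le Q 0 hr ht
  have h2 := le_gaussAt_of_splits P 0 (hr.le.trans ht)
  rw [N.natDegree_left, hk] at h2
  refine le_trans ?_ h2
  have hct : c ≤ t := le_max_right _ _
  calc r * gaussAt Q 0 t ≤ r * (gaussAt Q 0 r * (t / r) ^ Q.natDegree) := by gcongr
    _ = ‖P.leadingCoeff‖ * (t ^ Q.natDegree * c * r ^ k) := by rw [hc, div_pow]; field_simp
    _ ≤ ‖P.leadingCoeff‖ * (t ^ Q.natDegree * t * t ^ k) := by gcongr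
    _ = _ := by ring

variable [IsUltrametricDist K]

/-- On the open disc of radius `r` the map multiplies absolute values by the multiplier. -/
lemma norm_eval (N : IsNormalized P Q d μ r) {z : K} (hz : ‖z‖ < r) :
    ‖P.eval z‖ = ‖P.derivative.eval 0‖ * ‖z‖ ∧ ‖Q.eval z‖ = ‖Q.eval 0‖ := by
  have key : ∀ p : K[X], (∀ α ∈ p.roots, r ≤ ‖α‖) → ‖p.eval z‖ = ‖p.eval 0‖ := by
    intro p hp
    rw [norm_eval_eq_prod, norm_eval_eq_prod]
    congr 2
    refine Multiset.map_congr rfl fun α hα => ?_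
    rw [sub_zero]
    refine norm_eq_of_norm_sub_lt ?_
    rw [sub_sub_cancel_left, norm_neg]
    exact hz.trans_le (hp α hα)
  obtain ⟨P₁, hP, h0, hr⟩ := N.exists_eq_X_mul
  refine ⟨?_, key Q N.le_right⟩
  rw [← h0, ← key P₁ hr]
  conv_lhs => rw [hP]
  rw [eval_mul, eval_X, norm_mul, mul_comm]

/-- A deficit of two roots makes `|W| t ^ 2 / |PQ|` nonincreasing from radius `r` on, and at `r` it
is at most `r` by the general upper bound for the Wronskian. -/
lemma gaussAt_wronsk_le (N : IsNormalized P Q d μ r) {t : ℝ} (ht : r ≤ t)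
    (h : ∀ s, r ≤ s → s < t →
      rootsIn (wronsk P Q) (closedBall 0 s) + 2 ≤ rootsIn (P * Q) (closedBall 0 s)) :
    gaussAt (wronsk P Q) 0 t * t ^ 2 ≤ r * gaussAt (P * Q) 0 t := by
  have h1 := gaussAt_ratio_le (p := wronsk P Q) N.mul_ne 0 2 N.radius_pos ht
    fun s t' hs hst ht' _ _ => h s hs (hst.trans_le ht')
  have g0 := gaussAt_pos N.mul_ne 0 N.radius_pos
  have g1 := gaussAt_pos N.mul_ne 0 (N.radius_pos.trans_le ht)
  have h2 := RationalDynamics.gaussAt_wronsk_le (p := P) (q := Q) 0 N.radius_pos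
  rw [← gaussAt_mul] at h2
  have h3 : gaussAt (wronsk P Q) 0 r * r ^ 2 / gaussAt (P * Q) 0 r ≤ r := by
    rw [div_le_iff₀ g0]
    calc _ = r * (r * gaussAt (wronsk P Q) 0 r) := by ring
      _ ≤ _ := mul_le_mul_of_nonneg_left h2 N.radius_pos.le
  exact (div_le_iff₀ g1).1 (h1.trans h3)

/-- If the root deficit of `W` were at least two at every radius before `|P / Q|` attains `r`, the
upper and lower bounds for `W` would make that radius at most `r / μ`, where `|P / Q|` is still
below `r` because `|λ| < μ ^ d`. -/
lemma exists_good_radius (N : IsNormalized P Q d μ r) :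
    ∃ R, r ≤ R ∧ (∀ t, 0 < t → t ≤ R → gaussAt P 0 t < r * gaussAt Q 0 t) ∧
      rootsIn (P * Q) (closedBall 0 R) ≤ rootsIn (wronsk P Q) (closedBall 0 R) + 1 := by
  have hr := N.radius_pos
  obtain ⟨T, hrT, hT⟩ := N.exists_large_radius
  have hcl : IsClosed {t | r * gaussAt Q 0 t ≤ gaussAt P 0 t} :=
    isClosed_le (continuous_const.mul (continuous_gaussAt Q 0)) (continuous_gaussAt P 0)
  -- `e` is the first radius at which the Gauss norm of `P / Q` attains `r`.
  obtain ⟨e, ⟨⟨her, heT⟩, he⟩, hmin⟩ := ((isCompact_Icc (a := r) (b := T)).inter_right hcl).exists_isLeast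
    ⟨T, ⟨hrT, le_rfl⟩, hT⟩
  have hlt : ∀ t, 0 < t → t < e → gaussAt P 0 t < r * gaussAt Q 0 t := by
    intro t ht hte
    rcases le_or_gt t r with h | h
    · exact N.gaussAt_lt ht h
    · by_contra! hcon
      exact not_le.2 hte (hmin ⟨⟨h.le, hte.le.trans heT⟩, hcon⟩)
  have hre : r < e := lt_of_le_of_ne her fun h => not_le.2 (N.gaussAt_lt hr le_rfl) (h ▸ he)
  by_contra! hcon
  have hbad : ∀ s, r ≤ s → s < e →
      rootsIn (wronsk P Q) (closedBall 0 s) + 2 ≤ rootsIn (P * Q) (closedBall 0 s) :=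
    fun s hs hse => hcon s hs fun t ht hts => hlt t ht (hts.trans_lt hse)
  have hbound : ∀ᶠ s in 𝓝[<] e, s ≤ r / μ := by
    filter_upwards [eventually_left_no_roots P 0 e, eventually_left_no_roots Q 0 e,
      Ioo_mem_nhdsLT hre] with s hP hQ hs
    have hs0 := hr.trans hs.1
    -- With slope 0 on `[s, e]`, the quotient could not rise from below `r` at `s` to at least `r`
    -- at `e`.
    have hcnt : rootsIn P (closedBall 0 s) ≠ rootsIn Q (closedBall 0 s) := by
      intro h
      have h1 := gaussAt_mul_le_of_rootsIn_le P Q 0 hs0 hs.2.le hP hQ h.le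
      have h2 := mul_lt_mul_of_pos_right (hlt s hs0 hs.2) (gaussAt_pos N.right_ne 0 (hr.trans hre))
      have h3 := mul_le_mul_of_nonneg_right he (gaussAt_nonneg Q 0 hs0.le)
      nlinarith
    have h1 := N.le_norm_sub (N.rootsIn_left_le (closedBall 0 s)) (N.rootsIn_right_le _) hcnt
    have h2 := le_gaussAt_wronsk N.left_ne N.right_ne 0 hs0
    have h3 := N.gaussAt_wronsk_le hs.1.le fun s' h h' => hbad s' h (h'.trans hs.2)
    have hg := gaussAt_pos N.mul_ne 0 hs0
    rw [← gaussAt_mul] at h2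
    rw [le_div_iff₀ N.pos]
    refine le_of_mul_le_mul_right (a := gaussAt (P * Q) 0 s) ?_ hg
    calc s * μ * gaussAt (P * Q) 0 s ≤ s * (s * gaussAt (wronsk P Q) 0 s) := by
          rw [mul_assoc]
          exact mul_le_mul_of_nonneg_left
            ((mul_le_mul_of_nonneg_right h1 hg.le).trans h2) hs0.le
      _ = gaussAt (wronsk P Q) 0 s * s ^ 2 := by ring
      _ ≤ _ := h3
  have hle : e ≤ r / μ := le_of_tendsto (tendsto_id.mono_left nhdsWithin_le_nhds) hbound
  have h1 := gaussAt_le_of_le P 0 hr her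
  have h2 := gaussAt_mono Q 0 hr.le her
  rw [N.natDegree_left, N.gaussAt_left hr.le le_rfl] at h1
  rw [N.gaussAt_right le_rfl] at h2
  have h3 : e / r ≤ 1 / μ := by
    rw [div_le_div_iff₀ hr N.pos]
    rw [le_div_iff₀ N.pos] at hle
    linarith
  have hμ := N.pos
  have he0 := hr.trans hre
  -- From `r` to `e` the norm of `P` grows by at most `(e / r) ^ d ≤ μ⁻ᵈ`, while that of `Q` does
  -- not drop; the bound on the multiplier excludes this.
  have h4 : r * ‖Q.eval 0‖ ≤ ‖P.derivative.eval 0‖ * r * (1 / μ) ^ d :=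
    calc r * ‖Q.eval 0‖ ≤ r * gaussAt Q 0 e := by gcongr
      _ ≤ gaussAt P 0 e := he
      _ ≤ ‖P.derivative.eval 0‖ * r * (e / r) ^ d := h1
      _ ≤ _ := by gcongr
  have h5 : ‖P.derivative.eval 0‖ * r * (1 / μ) ^ d < μ ^ d * ‖Q.eval 0‖ * r * (1 / μ) ^ d := by
    have := N.lt
    gcongr
  have h6 : μ ^ d * ‖Q.eval 0‖ * r * (1 / μ) ^ d = r * ‖Q.eval 0‖ := by
    rw [div_pow, one_pow]; field_simp
  linarith

/-- The smallest good radius. -/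
lemma exists_minimal_good_radius (N : IsNormalized P Q d μ r) :
    ∃ R, r ≤ R ∧ (∀ t, 0 < t → t ≤ R → gaussAt P 0 t < r * gaussAt Q 0 t) ∧
      rootsIn (P * Q) (closedBall 0 R) ≤ rootsIn (wronsk P Q) (closedBall 0 R) + 1 ∧
      ∀ s, r ≤ s → s < R →
        rootsIn (wronsk P Q) (closedBall 0 s) + 2 ≤ rootsIn (P * Q) (closedBall 0 s) := by
  classical
  obtain ⟨R₀, hR₀, haxis, hgood⟩ := N.exists_good_radius
  set S : Finset ℝ := insert r (((P * Q).roots + (wronsk P Q).roots).toFinset.image fun α => ‖α‖)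
    with hS
  set good : ℝ → Prop := fun R => r ≤ R ∧
    rootsIn (P * Q) (closedBall 0 R) ≤ rootsIn (wronsk P Q) (closedBall 0 R) + 1 with hgd
  -- Root counts in closed discs jump only at absolute values of roots, so a good radius can be
  -- lowered to the nearest element of `S`. Including `r` in `S` keeps it at least `r`.
  have hdown : ∀ R, good R → ∃ x ∈ S, x ≤ R ∧ good x := by
    rintro R ⟨hrR, hR⟩
    obtain ⟨x, hx, hmax⟩ := (S.filter (· ≤ R)).exists_max_image id
      ⟨r, by simp [hS, hrR]⟩
    rw [Finset.mem_filter] at hx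
    have key : ∀ p : K[X], p.roots ≤ (P * Q).roots + (wronsk P Q).roots →
        rootsIn p (closedBall 0 R) = rootsIn p (closedBall 0 x) := by
      intro p hp
      unfold rootsIn
      congr 1
      refine Multiset.filter_congr fun α hα => ?_
      rw [mem_closedBall_zero_iff, mem_closedBall_zero_iff]
      refine ⟨fun h => ?_, fun h => h.trans hx.2⟩
      refine hmax _ (Finset.mem_filter.2 ⟨Finset.mem_insert_of_mem
        (Finset.mem_image_of_mem _ (Multiset.mem_toFinset.2 (Multiset.mem_of_le hp hα))), h⟩)
    refine ⟨x, hx.1, hx.2, hmax r (by simp [hS, hrR]), ?_⟩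
    rwa [← key _ (Multiset.le_add_right _ _), ← key _ (Multiset.le_add_left _ _)]
  obtain ⟨x₀, hx₀, hx₀R, hx₀g⟩ := hdown R₀ ⟨hR₀, hgood⟩
  obtain ⟨R, hR, hmin⟩ := (S.filter good).exists_min_image id ⟨x₀, Finset.mem_filter.2 ⟨hx₀, hx₀g⟩⟩
  have hRg := (Finset.mem_filter.1 hR).2
  have hRR : R ≤ R₀ := (hmin x₀ (Finset.mem_filter.2 ⟨hx₀, hx₀g⟩)).trans hx₀R
  refine ⟨R, hRg.1, fun t ht htR => haxis t ht (htR.trans hRR), hRg.2, fun s hs hsR => ?_⟩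
  by_contra! hcon
  obtain ⟨x, hx, hxs, hxg⟩ := hdown s ⟨hs, by omega⟩
  exact not_le.2 hsR ((hmin x (Finset.mem_filter.2 ⟨hx, hxg⟩)).trans hxs)

/-- Near the pole `b` the norm of `Q` tends to 0 with the radius, while that of `P` stays at least
`|P(b)| > 0`. -/
lemma exists_small_radius (N : IsNormalized P Q d μ r) {b : K} (hb : b ∈ Q.roots) {B : ℝ}
    (hB : 0 < B) : ∃ s, 0 < s ∧ s ≤ B ∧ r * gaussAt Q b s ≤ gaussAt P b s := by
  have hr := N.radius_pos
  have hPb : 0 < ‖P.eval b‖ := norm_pos_iff.2 fun h => N.right_eval_ne h (isRoot_of_mem_roots hb)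
  obtain ⟨Q₁, hQ⟩ := dvd_iff_isRoot.2 (isRoot_of_mem_roots hb)
  have hQ₁ : Q₁ ≠ 0 := by
    rintro rfl
    exact N.right_ne (by simpa using hQ)
  have hg := gaussAt_pos hQ₁ b hB
  have hs : 0 < min B (‖P.eval b‖ / (r * gaussAt Q₁ b B)) := lt_min hB (by positivity)
  refine ⟨_, hs, min_le_left _ _, le_trans ?_ (norm_eval_le_gaussAt P b hs)⟩
  have hle : min B (‖P.eval b‖ / (r * gaussAt Q₁ b B)) ≤ _ := min_le_right _ _
  have hleB : min B (‖P.eval b‖ / (r * gaussAt Q₁ b B)) ≤ B := min_le_left _ _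
  set s := min B (‖P.eval b‖ / (r * gaussAt Q₁ b B))
  have hX : gaussAt (X - C b) b s = s := by simp [gaussAt, hs.le]
  rw [hQ, gaussAt_mul, hX]
  calc r * (s * gaussAt Q₁ b s) ≤ r * (s * gaussAt Q₁ b B) := by
        have := gaussAt_mono Q₁ b hs.le hleB
        gcongr
    _ = s * (r * gaussAt Q₁ b B) := by ring
    _ ≤ _ := (le_div_iff₀ (by positivity)).1 hle

/-- Around a pole that is not larger than the smallest good radius there is a disc which contains
more zeros and poles of `P / Q` than zeros of the Wronskian. -/
lemma exists_hole (N : IsNormalized P Q d μ r) {b : K} (hb : b ∈ Q.roots)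
    (haxis : ∀ t, 0 < t → t ≤ ‖b‖ → gaussAt P 0 t < r * gaussAt Q 0 t)
    (hbad : ∀ s, r ≤ s → s < ‖b‖ →
      rootsIn (wronsk P Q) (closedBall 0 s) + 2 ≤ rootsIn (P * Q) (closedBall 0 s)) :
    ∃ t, 0 < t ∧ t ≤ ‖b‖ ∧
      (∀ s, t ≤ s → s ≤ ‖b‖ → gaussAt P b s < r * gaussAt Q b s) ∧
      rootsIn (wronsk P Q) (ball b t) + 1 ≤ rootsIn (P * Q) (ball b t) := by
  have hr := N.radius_pos
  have hrB := N.le_right b hb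
  set B := ‖b‖ with hBdef
  have hB : 0 < B := hr.trans_le hrB
  have hcen : ∀ p : K[X], gaussAt p b B = gaussAt p 0 B := fun p =>
    gaussAt_center p (by rw [sub_zero])
  obtain ⟨s₀, hs₀, hs₀B, hs₀'⟩ := N.exists_small_radius hb hB
  have hcl : IsClosed {t | r * gaussAt Q b t ≤ gaussAt P b t} :=
    isClosed_le (continuous_const.mul (continuous_gaussAt Q b)) (continuous_gaussAt P b)
  -- Going from radius `B` in towards the pole, `e` is where `|P / Q|` first attains `r`.
  obtain ⟨e, ⟨⟨hs₀e, heB⟩, he⟩, hmax⟩ :=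
    ((isCompact_Icc (a := s₀) (b := B)).inter_right hcl).exists_isGreatest ⟨s₀, ⟨le_rfl, hs₀B⟩, hs₀'⟩
  have he0 : 0 < e := hs₀.trans_le hs₀e
  have hlt : ∀ t, e < t → t ≤ B → gaussAt P b t < r * gaussAt Q b t := by
    intro t het htB
    by_contra! hcon
    exact not_le.2 het (hmax ⟨⟨hs₀e.trans het.le, htB⟩, hcon⟩)
  have heltB : e < B := lt_of_le_of_ne heB fun h => by
    have := haxis B hB le_rfl
    rw [← hcen, ← hcen, ← h] at this
    exact not_le.2 this he
  by_contra! hcon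
  -- Without a hole, `W` has at least as many roots as `PQ` in all these discs, so `|PQ| / |W|` does
  -- not increase from `e` to `B`.
  have hinner : ∀ t, e < t → t ≤ B → rootsIn (P * Q) (ball b t) ≤ rootsIn (wronsk P Q) (ball b t) :=
    fun t het htB => Nat.lt_succ_iff.1 (hcon t (he0.trans het) htB fun s hts hsB =>
      hlt s (het.trans_le hts) hsB)
  -- Slope 0 just outside `e` would keep `|P / Q|` at least `r` there.
  have hcnt : rootsIn P (closedBall b e) ≠ rootsIn Q (closedBall b e) := by
    intro h
    obtain ⟨t, ⟨hP, hQ⟩, ht⟩ := (((eventually_right_no_roots P b e).and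
      (eventually_right_no_roots Q b e)).and (Ioo_mem_nhdsGT heltB)).exists
    have h1 := gaussAt_mul_le_of_rootsIn_le Q P b he0 ht.1.le hQ hP h.ge
    have h2 := mul_lt_mul_of_pos_right (hlt t ht.1 ht.2.le) (gaussAt_pos N.right_ne b he0)
    have h3 := mul_le_mul_of_nonneg_right he (gaussAt_nonneg Q b (he0.trans ht.1).le)
    nlinarith
  have h1 := N.le_norm_sub (N.rootsIn_left_le (closedBall b e)) (N.rootsIn_right_le _) hcnt
  have h2 := le_gaussAt_wronsk N.left_ne N.right_ne b he0
  have h3 := N.gaussAt_wronsk_le hrB hbad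
  have h4 := gaussAt_ratio_le (p := P * Q) N.wronsk_ne b 0 he0 heB
    fun s t hs hst ht h h' => by
      rw [add_zero, ← h, ← h']; exact hinner t (hs.trans_lt hst) ht
  have hμ := N.pos
  rw [← gaussAt_mul] at h2
  rw [← hcen, ← hcen] at h3
  have gWe := gaussAt_pos N.wronsk_ne b he0
  have gWB := gaussAt_pos N.wronsk_ne b hB
  have gPe := gaussAt_pos N.mul_ne b he0
  have gPB := gaussAt_pos N.mul_ne b hB
  -- `B ^ 2 / r` bounds `|PQ| / |W|` from below at radius `B`, and `e / μ` bounds it from above at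
  -- `e`.
  have hkey : μ * B ^ 2 ≤ e * r := by
    have h2' : μ * gaussAt (P * Q) b e ≤ e * gaussAt (wronsk P Q) b e :=
      (mul_le_mul_of_nonneg_right h1 gPe.le).trans h2
    simp only [pow_zero, mul_one] at h4
    have h5 : gaussAt (P * Q) b e / gaussAt (wronsk P Q) b e ≤ e / μ := by
      rw [div_le_div_iff₀ gWe hμ]; linarith
    have h6 : B ^ 2 / r ≤ gaussAt (P * Q) b B / gaussAt (wronsk P Q) b B := by
      rw [div_le_div_iff₀ hr gWB]; linarith
    have h7 := h6.trans (h4.trans h5)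
    rw [div_le_div_iff₀ hr hμ] at h7
    linarith
  have h5 := gaussAt_le_of_le P 0 hr hrB
  rw [N.natDegree_left, N.gaussAt_left hr.le le_rfl] at h5
  have h6 := gaussAt_mono Q 0 hr.le hrB
  rw [N.gaussAt_right le_rfl] at h6
  have h7 := gaussAt_mono P b he0.le heB
  have h8 : gaussAt Q b B ≤ gaussAt Q b e * (B / e) ^ d :=
    (gaussAt_le_of_le Q b he0 heB).trans (mul_le_mul_of_nonneg_left
      (pow_le_pow_right₀ ((one_le_div he0).2 heB) N.natDegree_right.le)
      (gaussAt_nonneg Q b he0.le))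
  rw [hcen] at h7 h8
  -- Along the path of discs from `D(0, r)` out to `D(0, B) = D(b, B)` and in to `D(b, e)`, `|P /
  -- Q|` grows at most by `(B / r) ^ d` and then by `(B / e) ^ d`; by `hkey` the product is at most
  -- `μ⁻ᵈ`.
  have h9 : r * ‖Q.eval 0‖ ≤ ‖P.derivative.eval 0‖ * r * (B / r) ^ d * (B / e) ^ d :=
    calc r * ‖Q.eval 0‖ ≤ r * (gaussAt Q b e * (B / e) ^ d) := by
          have := h6.trans h8
          gcongr
      _ = r * gaussAt Q b e * (B / e) ^ d := by ring
      _ ≤ ‖P.derivative.eval 0‖ * r * (B / r) ^ d * (B / e) ^ d := by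
          have := he.trans (h7.trans h5)
          gcongr
  have h10 : (B / r) ^ d * (B / e) ^ d ≤ (1 / μ) ^ d := by
    rw [← mul_pow]
    refine pow_le_pow_left₀ (by positivity) ?_ d
    rw [div_mul_div_comm, div_le_div_iff₀ (by positivity) hμ]
    linarith
  have h11 : ‖P.derivative.eval 0‖ * r * (1 / μ) ^ d < μ ^ d * ‖Q.eval 0‖ * r * (1 / μ) ^ d := by
    have := N.lt
    gcongr
  have h12 : μ ^ d * ‖Q.eval 0‖ * r * (1 / μ) ^ d = r * ‖Q.eval 0‖ := by
    rw [div_pow, one_pow]; field_simp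
  have h13 : ‖P.derivative.eval 0‖ * r * ((B / r) ^ d * (B / e) ^ d) ≤
      ‖P.derivative.eval 0‖ * r * (1 / μ) ^ d := by gcongr
  linarith

end IsNormalized

end Normalized

/-! ### Counting critical points outside the holes -/

section Counting

variable {K : Type*} [NormedField K]

lemma rootsIn_union (p : K[X]) {s t : Set K} (h : Disjoint s t) :
    rootsIn p (s ∪ t) = rootsIn p s + rootsIn p t := by
  classical
  unfold rootsIn
  induction p.roots using Multiset.induction with
  | empty => rfl
  | cons a m ih =>
    simp only [Multiset.filter_cons, Multiset.card_add]
    rw [ih]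
    have : ¬ (a ∈ s ∧ a ∈ t) := fun ⟨h1, h2⟩ => Set.disjoint_left.1 h h1 h2
    by_cases h1 : a ∈ s <;> by_cases h2 : a ∈ t
    · exact absurd ⟨h1, h2⟩ this
    all_goals simp [h1, h2, add_assoc, add_left_comm]

lemma rootsIn_sUnion_add_card_le {w p : K[X]} (H : Finset (Set K))
    (hdisj : (H : Set (Set K)).PairwiseDisjoint id)
    (h : ∀ D ∈ H, rootsIn w D + 1 ≤ rootsIn p D) :
    rootsIn w (⋃₀ (H : Set (Set K))) + H.card ≤ rootsIn p (⋃₀ (H : Set (Set K))) := by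
  classical
  induction H using Finset.induction with
  | empty =>
    have : ∀ q : K[X], rootsIn q (∅ : Set K) = 0 := fun q => by simp [rootsIn]
    simp [this]
  | insert D H hD ih =>
    have hdisj' : Disjoint D (⋃₀ (H : Set (Set K))) := by
      rw [Set.disjoint_sUnion_right]
      intro E hE
      exact hdisj (by simp) (by simpa using Or.inr hE) (by rintro rfl; exact hD hE)
    rw [Finset.coe_insert, Set.sUnion_insert, rootsIn_union w hdisj', rootsIn_union p hdisj',
      Finset.card_insert_of_notMem hD]
    have h1 := ih (hdisj.subset (by simp)) fun E hE => h E (by simp [hE])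
    have h2 := h D (by simp)
    omega

/-- A power `(X - a) ^ e` dividing both `p` and `W` divides `p' q`, hence `p'`, as `q` does not
vanish at `a`. But `p'` has multiplicity exactly `e - 1` when `e ≠ 0` in `K`. -/
lemma rootMultiplicity_wronsk_add_one_le {p q : K[X]} {a : K} (hw : wronsk p q ≠ 0) (hp : p ≠ 0)
    (hp' : derivative p ≠ 0)
    (hpa : p.eval a = 0) (hqa : q.eval a ≠ 0) (he : (rootMultiplicity a p : K) ≠ 0) :
    rootMultiplicity a (wronsk p q) + 1 ≤ rootMultiplicity a p := by
  by_contra! hcon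
  have hroot : p.IsRoot a := hpa
  have hpos : 0 < rootMultiplicity a p := (rootMultiplicity_pos hp).2 hroot
  have h1 : (X - C a) ^ rootMultiplicity a p ∣ wronsk p q :=
    (le_rootMultiplicity_iff hw).1 (by omega)
  have h2 : (X - C a) ^ rootMultiplicity a p ∣ derivative p * q := by
    have := dvd_add h1 ((pow_rootMultiplicity_dvd p a).mul_right (derivative q))
    rwa [wronsk, sub_add_cancel] at this
  have hco : IsCoprime ((X - C a) ^ rootMultiplicity a p) q :=
    IsCoprime.pow_left ((irreducible_X_sub_C a).coprime_iff_not_dvd.2 fun h =>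
      hqa (dvd_iff_isRoot.1 h))
  have h3 := (le_rootMultiplicity_iff hp').2 (hco.dvd_of_dvd_mul_right h2)
  rw [derivative_rootMultiplicity_of_root_of_mem_nonZeroDivisors hroot
    (mem_nonZeroDivisors_of_ne_zero he)] at h3
  omega

namespace IsNormalized

variable {P Q : K[X]} {d : ℕ} {μ r : ℝ}

/-- Multiplicities are compared point by point: each distinct zero of `P` costs `W` at least one
root. Multiplicities are at most `d`, so they do not vanish in `K`. -/
lemma exists_rootsIn_wronsk_add_card_le (N : IsNormalized P Q d μ r) {S : Set K}
    (h : ∀ w ∈ S, (wronsk P Q).eval w = 0 → P.eval w = 0) :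
    ∃ T : Finset K, (∀ a, a ∈ T ↔ a ∈ P.roots ∧ a ∈ S) ∧
      rootsIn (wronsk P Q) S + T.card ≤ rootsIn P S := by
  classical
  refine ⟨(P.roots.filter (· ∈ S)).toFinset, fun a => by
    rw [Multiset.mem_toFinset, Multiset.mem_filter], ?_⟩
  unfold rootsIn
  rw [Multiset.card_toFinset]
  rw [← Multiset.card_add]
  refine Multiset.card_le_card (Multiset.le_iff_count.2 fun a => ?_)
  rw [Multiset.count_add, Multiset.count_dedup]
  by_cases ha : a ∈ S
  swap
  · simp [ha]
  rw [Multiset.count_filter_of_pos ha, Multiset.count_filter_of_pos ha, count_roots, count_roots]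
  by_cases hPa : P.eval a = 0
  · have hmem : a ∈ P.roots.filter (· ∈ S) :=
      Multiset.mem_filter.2 ⟨(mem_roots N.left_ne).2 hPa, ha⟩
    rw [if_pos hmem]
    have hP' : derivative P ≠ 0 := fun h => N.derivative_ne (by simp [h])
    refine rootMultiplicity_wronsk_add_one_le N.wronsk_ne N.left_ne hP' hPa (N.right_eval_ne hPa) ?_
    have h1 : 0 < rootMultiplicity a P := (rootMultiplicity_pos N.left_ne).2 hPa
    have h2 : rootMultiplicity a P ≤ d := by
      rw [← count_roots, ← N.natDegree_left]
      exact (Multiset.count_le_card _ _).trans (card_roots' P)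
    exact norm_pos_iff.1 (N.pos.trans_le (N.le_norm _ h1 h2))
  · have h1 : rootMultiplicity a (wronsk P Q) = 0 :=
      rootMultiplicity_eq_zero fun hr => hPa (h a ha hr)
    have h2 : a ∉ P.roots.filter (· ∈ S) := fun hmem =>
      hPa (isRoot_of_mem_roots (Multiset.mem_filter.1 hmem).1)
    rw [h1, if_neg h2]
    exact Nat.zero_le _

variable [IsAlgClosed K] [IsUltrametricDist K]

/-- A normalized rational function has a finite critical point that is not a pole and that is
mapped into the open disc of radius `r`, but not to `0`. -/
theorem exists_critical (N : IsNormalized P Q d μ r) :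
    ∃ w, (wronsk P Q).eval w = 0 ∧ P.eval w ≠ 0 ∧ ‖P.eval w‖ < r * ‖Q.eval w‖ := by
  classical
  obtain ⟨R, hrR, haxis, hgood, hbad⟩ := N.exists_minimal_good_radius
  have hr := N.radius_pos
  have hR := hr.trans_le hrR
  have hole : ∀ b : K, ∃ t : ℝ, b ∈ Q.roots → ‖b‖ ≤ R → 0 < t ∧ t ≤ ‖b‖ ∧
      (∀ s, t ≤ s → s ≤ ‖b‖ → gaussAt P b s < r * gaussAt Q b s) ∧
      rootsIn (wronsk P Q) (ball b t) + 1 ≤ rootsIn (P * Q) (ball b t) := by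
    intro b
    by_cases h : b ∈ Q.roots ∧ ‖b‖ ≤ R
    · obtain ⟨t, ht⟩ := N.exists_hole h.1 (fun t ht htb => haxis t ht (htb.trans h.2))
        fun s hs hsb => hbad s hs (hsb.trans_le h.2)
      exact ⟨t, fun _ _ => ht⟩
    · exact ⟨0, fun h1 h2 => absurd ⟨h1, h2⟩ h⟩
  choose t ht using hole
  set Z : Finset K := Q.roots.toFinset.filter fun b => ‖b‖ ≤ R with hZ
  have hZmem : ∀ b, b ∈ Z ↔ b ∈ Q.roots ∧ ‖b‖ ≤ R := fun b => by
    rw [hZ, Finset.mem_filter, Multiset.mem_toFinset]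
  set F : Finset (Set K) := Z.image fun b => ball b (t b) with hF
  -- Two ultrametric discs are nested or disjoint, so the maximal ones are pairwise disjoint and
  -- still cover the poles.
  set H : Finset (Set K) := F.filter fun D => Maximal (· ∈ F) D with hH
  have hHball : ∀ D ∈ H, ∃ b ∈ Z, D = ball b (t b) := fun D hD => by
    obtain ⟨b, hb, rfl⟩ := Finset.mem_image.1 (Finset.mem_filter.1 hD).1
    exact ⟨b, hb, rfl⟩
  have hdisj : (H : Set (Set K)).PairwiseDisjoint id := by
    intro D hD E hE hne
    have hDm := (Finset.mem_filter.1 hD).2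
    have hEm := (Finset.mem_filter.1 hE).2
    obtain ⟨b, hb, rfl⟩ := hHball D hD
    obtain ⟨c, hc, rfl⟩ := hHball E hE
    rcases IsUltrametricDist.ball_subset_trichotomy (x := b) (y := c) (r := t b) (s := t c)
      with h | h | h
    · exact absurd (hDm.eq_of_le hEm.prop h) hne
    · exact absurd (hEm.eq_of_le hDm.prop h).symm hne
    · exact h
  have hcover : ∀ b ∈ Z, ∃ D ∈ H, b ∈ D := by
    intro b hb
    obtain ⟨D, hbD, hD⟩ := F.exists_le_maximal (Finset.mem_image_of_mem _ hb)
    refine ⟨D, Finset.mem_filter.2 ⟨hD.prop, hD⟩, hbD (mem_ball_self ?_)⟩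
    exact (ht b ((hZmem b).1 hb).1 ((hZmem b).1 hb).2).1
  have hHspec : ∀ D ∈ H, rootsIn (wronsk P Q) D + 1 ≤ rootsIn (P * Q) D := by
    intro D hD
    obtain ⟨b, hb, rfl⟩ := hHball D hD
    exact (ht b ((hZmem b).1 hb).1 ((hZmem b).1 hb).2).2.2.2
  set U : Set K := ⋃₀ (H : Set (Set K)) with hU
  set S : Set K := closedBall 0 R \ U with hS
  have hUsub : U ⊆ closedBall 0 R := by
    rintro z ⟨D, hD, hz⟩
    obtain ⟨b, hb, rfl⟩ := hHball D hD
    obtain ⟨hbQ, hbR⟩ := (hZmem b).1 hb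
    rw [mem_ball, dist_eq_norm] at hz
    rw [mem_closedBall_zero_iff]
    have := IsUltrametricDist.norm_add_le_max (z - b) b
    rw [sub_add_cancel] at this
    exact this.trans (max_le (hz.le.trans ((ht b hbQ hbR).2.1.trans hbR)) hbR)
  have hsplit : ∀ p : K[X], rootsIn p (closedBall 0 R) = rootsIn p S + rootsIn p U := fun p => by
    rw [hS, ← rootsIn_union p Set.disjoint_sdiff_left, Set.sdiff_union_of_subset hUsub]
  -- Otherwise the deficits add up: `T.card + H.card ≤ 1`. Since `0 ∈ T`, there is no hole and no
  -- other zero, yet the zero or pole of absolute value `r` lies in `D(0, R)`.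
  have hcrit : ∃ w ∈ S, (wronsk P Q).eval w = 0 ∧ P.eval w ≠ 0 := by
    by_contra! hcon
    obtain ⟨T, hT, h1⟩ := N.exists_rootsIn_wronsk_add_card_le hcon
    have h2 := rootsIn_sUnion_add_card_le H hdisj hHspec
    rw [← hU] at h2
    rw [hsplit, hsplit, rootsIn_mul N.left_ne N.right_ne S] at hgood
    have h0U : (0 : K) ∉ U := by
      rintro ⟨D, hD, hz⟩
      obtain ⟨b, hb, rfl⟩ := hHball D hD
      obtain ⟨hbQ, hbR⟩ := (hZmem b).1 hb
      rw [mem_ball, dist_eq_norm, zero_sub, norm_neg] at hz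
      exact not_le.2 hz (ht b hbQ hbR).2.1
    have h0 : (0 : K) ∈ T := by
      rw [hT]
      exact ⟨(mem_roots N.left_ne).2 N.eval_zero, by simpa using hR.le, h0U⟩
    have h3 : 0 < T.card := Finset.card_pos.2 ⟨0, h0⟩
    have hcard : T.card = 1 := by omega
    have hHe : H = ∅ := by
      rw [← Finset.card_eq_zero]; omega
    have hUe : U = ∅ := by rw [hU, hHe]; simp
    obtain ⟨α, hα, hαr⟩ := N.exists_root
    have hα0 : α ≠ 0 := norm_pos_iff.1 (hαr ▸ hr)
    have hαR : ‖α‖ ≤ R := hαr.trans_le hrR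
    rcases hα with hα | hα
    · have : α ∈ T := by
        rw [hT]
        refine ⟨hα, by simpa using hαR, ?_⟩
        rw [hUe]; simp
      obtain ⟨x, hx⟩ := Finset.card_eq_one.1 hcard
      rw [hx, Finset.mem_singleton] at this h0
      exact hα0 (this.trans h0.symm)
    · obtain ⟨D, hD, -⟩ := hcover α ((hZmem α).2 ⟨hα, hαR⟩)
      rw [hHe] at hD
      simp at hD
  obtain ⟨w, ⟨hwR, hwU⟩, hw, hPw⟩ := hcrit
  refine ⟨w, hw, hPw, ?_⟩
  rw [mem_closedBall_zero_iff] at hwR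
  have hw0 : w ≠ 0 := by
    rintro rfl
    exact hPw N.eval_zero
  have hwpos : 0 < ‖w‖ := norm_pos_iff.2 hw0
  -- `s` is the smaller of `|w|` and the distance from `w` to the nearest pole, so that `|Q(w)|` is
  -- the Gauss norm of `Q` on `D(w, s)`. This disc equals one centred at 0, or one centred at a pole
  -- and of radius no smaller than its hole; on both kinds `|P| < r |Q|` is known.
  obtain ⟨s, hs0, hsw, hsQ, hslt⟩ : ∃ s, 0 < s ∧ s ≤ ‖w‖ ∧ (∀ b ∈ Q.roots, s ≤ ‖b - w‖) ∧
      gaussAt P w s < r * gaussAt Q w s := by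
    by_cases hall : ∀ b ∈ Q.roots, ‖w‖ ≤ ‖b - w‖
    · refine ⟨‖w‖, hwpos, le_rfl, hall, ?_⟩
      rw [gaussAt_center P (c := 0) (by rw [sub_zero]), gaussAt_center Q (c := 0) (by rw [sub_zero])]
      exact haxis _ hwpos hwR
    · push Not at hall
      obtain ⟨b₀, hb₀, hb₀w⟩ := hall
      obtain ⟨b, hb, hbmin⟩ := Q.roots.toFinset.exists_min_image (fun b => ‖b - w‖)
        ⟨b₀, Multiset.mem_toFinset.2 hb₀⟩
      have hbw : ‖b - w‖ < ‖w‖ := (hbmin b₀ (Multiset.mem_toFinset.2 hb₀)).trans_lt hb₀w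
      rw [Multiset.mem_toFinset] at hb
      have hbR : ‖b‖ ≤ R := by
        have := IsUltrametricDist.norm_add_le_max (b - w) w
        rw [sub_add_cancel] at this
        exact this.trans (max_le (hbw.le.trans hwR) hwR)
      obtain ⟨D, hD, hbD⟩ := hcover b ((hZmem b).2 ⟨hb, hbR⟩)
      have hwD : w ∉ D := fun h => hwU ⟨D, hD, h⟩
      obtain ⟨c, hc, rfl⟩ := hHball D hD
      obtain ⟨hcQ, hcR⟩ := (hZmem c).1 hc
      obtain ⟨htpos, htc, hsmall, -⟩ := ht c hcQ hcR
      rw [mem_ball, dist_eq_norm] at hbD hwD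
      rw [not_lt] at hwD
      -- `b` lies in the hole around `c` and `w` does not, so `w` is equally far from `b` and `c`.
      have hbc : ‖b - w‖ = ‖w - c‖ := by
        rw [norm_sub_rev]
        refine norm_eq_of_norm_sub_lt ?_
        rw [sub_sub_sub_cancel_left, norm_sub_rev]
        exact hbD.trans_le hwD
      have hpos : 0 < ‖b - w‖ := hbc ▸ htpos.trans_le hwD
      refine ⟨‖b - w‖, hpos, hbw.le, fun b' hb' => hbmin b' (Multiset.mem_toFinset.2 hb'), ?_⟩
      rw [gaussAt_center P (c := c) hbc.ge, gaussAt_center Q (c := c) hbc.ge]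
      rcases le_or_gt ‖b - w‖ ‖c‖ with h | h
      · exact hsmall _ (hbc ▸ hwD) h
      · rw [gaussAt_center P (c := 0) (by rw [sub_zero]; exact h.le),
          gaussAt_center Q (c := 0) (by rw [sub_zero]; exact h.le)]
        exact haxis _ hpos (hbw.le.trans hwR)
  rw [norm_eval_eq_gaussAt Q w hsQ]
  exact (norm_eval_le_gaussAt P w hs0).trans_lt hslt

end IsNormalized

end Counting

/-! ### Translations, inversion and the chordal metric -/

section Chordal

variable {K : Type*} [NormedField K]

/-- The translation `z ↦ z + a` of the projective line. -/
def translate (a : K) : OnePoint K → OnePoint K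
  | ∞ => ∞
  | (z : K) => ((z + a : K) : OnePoint K)

open Classical in
/-- The inversion `z ↦ 1 / z` of the projective line. -/
def invert : OnePoint K → OnePoint K
  | ∞ => ((0 : K) : OnePoint K)
  | (z : K) => if z = 0 then ∞ else ((z⁻¹ : K) : OnePoint K)

lemma translate_infty (a : K) : translate a ∞ = ∞ := rfl

lemma translate_coe (a z : K) : translate a (z : OnePoint K) = ((z + a : K) : OnePoint K) := rfl

lemma invert_infty : invert (∞ : OnePoint K) = ((0 : K) : OnePoint K) := rfl

lemma invert_zero : invert ((0 : K) : OnePoint K) = ∞ := by simp [invert]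

lemma invert_coe {z : K} (hz : z ≠ 0) : invert (z : OnePoint K) = ((z⁻¹ : K) : OnePoint K) := by
  simp [invert, hz]

lemma invert_invert (x : OnePoint K) : invert (invert x) = x := by
  induction x using OnePoint.rec with
  | infty => rw [invert_infty, invert_zero]
  | coe z =>
    rcases eq_or_ne z 0 with rfl | hz
    · rw [invert_zero, invert_infty]
    · rw [invert_coe hz, invert_coe (inv_ne_zero hz), inv_inv]

lemma translate_injective (a : K) : Function.Injective (translate a) := by
  intro x y h
  induction x using OnePoint.rec <;> induction y using OnePoint.rec <;>
    simp_all [translate_infty, translate_coe]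

lemma chordal_infty_infty : chordal (∞ : OnePoint K) ∞ = 0 := rfl

lemma chordal_infty_coe (b : K) : chordal ∞ (b : OnePoint K) = 1 / max 1 ‖b‖ := rfl

lemma chordal_coe_infty (a : K) : chordal (a : OnePoint K) ∞ = 1 / max 1 ‖a‖ := rfl

lemma chordal_coe_coe (a b : K) :
    chordal (a : OnePoint K) (b : OnePoint K) = ‖a - b‖ / (max 1 ‖a‖ * max 1 ‖b‖) := rfl

lemma max_one_norm_pos (a : K) : 0 < max 1 ‖a‖ := lt_max_of_lt_left one_pos

lemma chordal_nonneg (x y : OnePoint K) : 0 ≤ chordal x y := by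
  induction x using OnePoint.rec with
  | infty =>
    induction y using OnePoint.rec with
    | infty => exact le_rfl
    | coe b => exact div_nonneg zero_le_one (max_one_norm_pos b).le
  | coe a =>
    induction y using OnePoint.rec with
    | infty => exact div_nonneg zero_le_one (max_one_norm_pos a).le
    | coe b =>
      exact div_nonneg (norm_nonneg _) (mul_pos (max_one_norm_pos a) (max_one_norm_pos b)).le

lemma max_one_norm_inv {a : K} (ha : a ≠ 0) : max 1 ‖a⁻¹‖ = max 1 ‖a‖ / ‖a‖ := by
  have h : 0 < ‖a‖ := norm_pos_iff.2 ha
  rw [norm_inv, ← max_div_div_right h.le, div_self h.ne', one_div, max_comm]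

lemma chordal_invert (x y : OnePoint K) : chordal (invert x) (invert y) = chordal x y := by
  have comm : ∀ x y : OnePoint K, chordal x y = chordal y x := by
    intro x y
    induction x using OnePoint.rec <;> induction y using OnePoint.rec
    · rfl
    · rfl
    · rfl
    · rw [chordal_coe_coe, chordal_coe_coe, norm_sub_rev, mul_comm]
  have hinf : ∀ b : K, chordal (invert ∞) (invert (b : OnePoint K)) = chordal ∞ (b : OnePoint K) := by
    intro b
    rw [invert_infty]
    rcases eq_or_ne b 0 with rfl | hb
    · rw [invert_zero, chordal_coe_infty, chordal_infty_coe]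
    · have h : 0 < ‖b‖ := norm_pos_iff.2 hb
      have := max_one_norm_pos b
      rw [invert_coe hb, chordal_coe_coe, chordal_infty_coe, max_one_norm_inv hb, zero_sub,
        norm_neg, norm_inv, norm_zero, max_eq_left zero_le_one]
      field_simp
  have hzero : ∀ b : K, b ≠ 0 → chordal (invert ((0 : K) : OnePoint K)) (invert (b : OnePoint K)) =
      chordal ((0 : K) : OnePoint K) (b : OnePoint K) := by
    intro b hb
    have h : 0 < ‖b‖ := norm_pos_iff.2 hb
    have := max_one_norm_pos b
    rw [invert_zero, invert_coe hb, chordal_infty_coe, chordal_coe_coe, max_one_norm_inv hb,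
      zero_sub, norm_neg, norm_zero, max_eq_left zero_le_one]
    field_simp
  induction x using OnePoint.rec with
  | infty =>
    induction y using OnePoint.rec with
    | infty => rw [invert_infty, chordal_coe_coe]; simp [chordal_infty_infty]
    | coe b => exact hinf b
  | coe a =>
    induction y using OnePoint.rec with
    | infty => rw [comm, hinf, comm]
    | coe b =>
      rcases eq_or_ne a 0 with rfl | ha
      · rcases eq_or_ne b 0 with rfl | hb
        · rw [invert_zero, chordal_coe_coe]; simp [chordal_infty_infty]
        · exact hzero b hb
      · rcases eq_or_ne b 0 with rfl | hb
        · rw [comm, hzero a ha, comm]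
        · have h1 : 0 < ‖a‖ := norm_pos_iff.2 ha
          have h2 : 0 < ‖b‖ := norm_pos_iff.2 hb
          have := max_one_norm_pos a
          have := max_one_norm_pos b
          rw [invert_coe ha, invert_coe hb, chordal_coe_coe, chordal_coe_coe, max_one_norm_inv ha,
            max_one_norm_inv hb, inv_sub_inv ha hb, norm_div, norm_mul, norm_sub_rev b a]
          field_simp

/-- Translation by `a` changes `max 1 ‖z‖` by at most the factor `max 1 ‖a‖`, and the chordal
distance of two finite points contains two such factors. -/
lemma chordal_translate_le [IsUltrametricDist K] (a : K) (x y : OnePoint K) :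
    chordal (translate a x) (translate a y) ≤ max 1 ‖a‖ ^ 2 * chordal x y := by
  have hA : 1 ≤ max 1 ‖a‖ := le_max_left _ _
  have key : ∀ z : K, 1 / max 1 ‖z + a‖ ≤ max 1 ‖a‖ * (1 / max 1 ‖z‖) := by
    intro z
    have h1 := max_one_norm_pos z
    have h2 := max_one_norm_pos (z + a)
    have h3 : max 1 ‖z‖ ≤ max 1 ‖a‖ * max 1 ‖z + a‖ := by
      refine max_le (one_le_mul_of_one_le_of_one_le hA (le_max_left _ _)) ?_
      have : ‖z‖ ≤ max ‖z + a‖ ‖a‖ := by simpa using norm_sub_le_max_norm (z + a) a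
      refine this.trans (max_le ?_ ?_)
      · exact (le_max_right 1 _).trans (le_mul_of_one_le_left h2.le hA)
      · exact (le_max_right 1 _).trans (le_mul_of_one_le_right (by positivity) (le_max_left _ _))
    rw [mul_one_div, div_le_div_iff₀ h2 h1]
    linarith
  have hAA : max 1 ‖a‖ ≤ max 1 ‖a‖ ^ 2 := by nlinarith
  induction x using OnePoint.rec with
  | infty =>
    induction y using OnePoint.rec with
    | infty => simp [translate_infty, chordal_infty_infty]
    | coe b =>
      rw [translate_infty, translate_coe, chordal_infty_coe, chordal_infty_coe]
      have := max_one_norm_pos b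
      exact (key b).trans (by gcongr)
  | coe z =>
    induction y using OnePoint.rec with
    | infty =>
      rw [translate_infty, translate_coe, chordal_coe_infty, chordal_coe_infty]
      have := max_one_norm_pos z
      exact (key z).trans (by gcongr)
    | coe b =>
      rw [translate_coe, translate_coe, chordal_coe_coe, chordal_coe_coe, add_sub_add_right_eq_sub]
      have h1 := key z
      have h2 := key b
      have := max_one_norm_pos z
      have := max_one_norm_pos b
      have := max_one_norm_pos (z + a)
      have := max_one_norm_pos (b + a)
      calc ‖z - b‖ / (max 1 ‖z + a‖ * max 1 ‖b + a‖) =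
          ‖z - b‖ * ((1 / max 1 ‖z + a‖) * (1 / max 1 ‖b + a‖)) := by field_simp
        _ ≤ ‖z - b‖ * ((max 1 ‖a‖ * (1 / max 1 ‖z‖)) * (max 1 ‖a‖ * (1 / max 1 ‖b‖))) := by gcongr
        _ = _ := by field_simp

end Chordal

/-! ### Rational maps as pairs of polynomials, and their conjugates -/

section Pairs

variable {K : Type*} [NormedField K]

/-- Two polynomials of degree at most `d` without common zeros on the projective line. -/
structure IsPair (d : ℕ) (P Q : K[X]) : Prop where
  natDegree_left : P.natDegree ≤ d
  natDegree_right : Q.natDegree ≤ d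
  eval_ne : ∀ a, P.eval a = 0 → Q.eval a ≠ 0
  coeff_ne : P.coeff d = 0 → Q.coeff d ≠ 0

open Classical in
/-- The point of the projective line with homogeneous coordinates `u` and `v`. -/
def ratioPoint (u v : K) : OnePoint K := if v = 0 then ∞ else ((u / v : K) : OnePoint K)

/-- The self-map of the projective line that is given by the homogenizations of `P` and `Q` in
degree `d`. -/
def pairMap (d : ℕ) (P Q : K[X]) : OnePoint K → OnePoint K
  | ∞ => ratioPoint (P.coeff d) (Q.coeff d)
  | (a : K) => ratioPoint (P.eval a) (Q.eval a)

/-- The Wronskian of `P` and `Q` in the standard coordinate of the projective line. -/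
def pairWronsk (d : ℕ) (P Q : K[X]) : OnePoint K → K
  | ∞ => P.coeff (d - 1) * Q.coeff d - P.coeff d * Q.coeff (d - 1)
  | (a : K) => (wronsk P Q).eval a

/-- The multiplier of `P / Q` at a fixed point. -/
def pairMult (d : ℕ) (P Q : K[X]) : OnePoint K → K
  | ∞ => (Q.coeff (d - 1) * P.coeff d - Q.coeff d * P.coeff (d - 1)) / P.coeff d ^ 2
  | (a : K) => (wronsk P Q).eval a / Q.eval a ^ 2

/-- The fixed point `γ` of `P / Q` strictly attracts a critical point. -/
def AttractsCritical (d : ℕ) (P Q : K[X]) (γ : OnePoint K) : Prop :=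
  ∃ c, pairWronsk d P Q c = 0 ∧
    Tendsto (fun n : ℕ => chordal ((pairMap d P Q)^[n] c) γ) atTop (𝓝 0) ∧
    ∀ l : ℕ, 1 ≤ l → (pairMap d P Q)^[l] c ≠ γ

lemma pairMap_infty_of_eq {d : ℕ} {P Q : K[X]} (h : Q.coeff d = 0) : pairMap d P Q ∞ = ∞ := by
  simp [pairMap, ratioPoint, h]

lemma pairMap_infty_of_ne {d : ℕ} {P Q : K[X]} (h : Q.coeff d ≠ 0) :
    pairMap d P Q ∞ = ((P.coeff d / Q.coeff d : K) : OnePoint K) := by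
  simp [pairMap, ratioPoint, h]

lemma pairMap_coe_of_eq {d : ℕ} {P Q : K[X]} {a : K} (h : Q.eval a = 0) :
    pairMap d P Q (a : OnePoint K) = ∞ := by
  simp [pairMap, ratioPoint, h]

lemma pairMap_coe_of_ne {d : ℕ} {P Q : K[X]} {a : K} (h : Q.eval a ≠ 0) :
    pairMap d P Q (a : OnePoint K) = ((P.eval a / Q.eval a : K) : OnePoint K) := by
  simp [pairMap, ratioPoint, h]

lemma pairMap_coe_eq_coe {d : ℕ} {P Q : K[X]} {a b : K} (h : pairMap d P Q (a : OnePoint K) = b) :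
    Q.eval a ≠ 0 ∧ P.eval a = b * Q.eval a := by
  by_cases hQ : Q.eval a = 0
  · rw [pairMap_coe_of_eq hQ] at h
    exact absurd h (OnePoint.infty_ne_coe b)
  · rw [pairMap_coe_of_ne hQ, OnePoint.coe_eq_coe] at h
    exact ⟨hQ, by rw [← h, div_mul_cancel₀ _ hQ]⟩

lemma coeff_eq_zero_of_pairMap_infty {d : ℕ} {P Q : K[X]} (h : pairMap d P Q ∞ = ∞) :
    Q.coeff d = 0 := by
  by_contra hQ
  rw [pairMap_infty_of_ne hQ] at h
  exact OnePoint.coe_ne_infty _ h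

/-- A semiconjugacy which is injective, Lipschitz for the chordal metric and preserves critical
points transports strictly attracted critical points. -/
lemma AttractsCritical.of_semiconj {d : ℕ} {P Q P' Q' : K[X]} {γ : OnePoint K}
    (σ : OnePoint K → OnePoint K) (hinj : Function.Injective σ) (C : ℝ)
    (hlip : ∀ x y, chordal (σ x) (σ y) ≤ C * chordal x y)
    (hsemi : Function.Semiconj σ (pairMap d P' Q') (pairMap d P Q))
    (hcrit : ∀ x, pairWronsk d P' Q' x = 0 → pairWronsk d P Q (σ x) = 0)
    (h : AttractsCritical d P' Q' γ) : AttractsCritical d P Q (σ γ) := by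
  obtain ⟨c, hc, hlim, hne⟩ := h
  have hit : ∀ n, (pairMap d P Q)^[n] (σ c) = σ ((pairMap d P' Q')^[n] c) := fun n =>
    ((hsemi.iterate_right n).eq c).symm
  refine ⟨σ c, hcrit c hc, ?_, fun l hl heq => hne l hl (hinj ?_)⟩
  · simp only [hit]
    exact squeeze_zero (fun n => chordal_nonneg _ _) (fun n => hlip _ _)
      (by simpa using hlim.const_mul C)
  · rw [← hit, heq]

/-! ### Conjugation by translations -/

section Translate

variable (a : K) (P Q : K[X])

lemma coeff_taylor_of_natDegree_le {d : ℕ} {p : K[X]} (hp : p.natDegree ≤ d) :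
    (taylor a p).coeff d = p.coeff d := by
  rcases hp.eq_or_lt with rfl | h
  · rw [coeff_taylor_natDegree]; rfl
  · rw [coeff_eq_zero_of_natDegree_lt h, coeff_eq_zero_of_natDegree_lt (by rwa [natDegree_taylor])]

/-- Only the monomials of degrees `d - 1` and `d` contribute. These two coefficients carry the
Wronskian and the multiplier at `∞`. -/
lemma coeff_taylor_pred {d : ℕ} (hd : 1 ≤ d) {p : K[X]} (hp : p.natDegree ≤ d) :
    (taylor a p).coeff (d - 1) = p.coeff (d - 1) + d * a * p.coeff d := by
  obtain ⟨e, rfl⟩ := Nat.exists_eq_add_of_le' hd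
  rw [taylor_coeff, hasseDeriv_apply, sum_over_range' _ _ (e + 2) (by omega)]
  · rw [Finset.sum_range_succ, Finset.sum_range_succ, Finset.sum_eq_zero]
    · simp [eval_add]
      ring
    · intro i hi
      rw [Nat.choose_eq_zero_of_lt (by simpa using hi)]
      simp
  · simp

/-- The pair of the conjugate `P / Q (z + a) - a`. -/
def translateLeft : K[X] := taylor a P - C a * taylor a Q

lemma wronsk_translate (x : K) :
    (wronsk (translateLeft a P Q) (taylor a Q)).eval x = (wronsk P Q).eval (x + a) := by
  simp only [wronsk, translateLeft, derivative_sub, derivative_mul, derivative_C, ← taylor_derivative,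
    eval_sub, eval_mul, eval_C, taylor_eval, zero_mul, zero_add]
  ring

variable {a P Q} {d : ℕ}

lemma coeff_translateLeft (h : IsPair d P Q) :
    (translateLeft a P Q).coeff d = P.coeff d - a * Q.coeff d := by
  rw [translateLeft, coeff_sub, coeff_C_mul, coeff_taylor_of_natDegree_le a h.natDegree_left,
    coeff_taylor_of_natDegree_le a h.natDegree_right]

lemma coeff_translateLeft_pred (hd : 1 ≤ d) (h : IsPair d P Q) :
    (translateLeft a P Q).coeff (d - 1) = P.coeff (d - 1) + d * a * P.coeff d -
      a * (Q.coeff (d - 1) + d * a * Q.coeff d) := by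
  rw [translateLeft, coeff_sub, coeff_C_mul, coeff_taylor_pred a hd h.natDegree_left,
    coeff_taylor_pred a hd h.natDegree_right]

lemma eval_translateLeft (x : K) :
    (translateLeft a P Q).eval x = P.eval (x + a) - a * Q.eval (x + a) := by
  simp [translateLeft, taylor_eval]

lemma IsPair.translate (h : IsPair d P Q) : IsPair d (translateLeft a P Q) (taylor a Q) where
  natDegree_left := by
    refine (natDegree_sub_le _ _).trans (max_le ?_ ((natDegree_C_mul_le _ _).trans ?_))
    · rw [natDegree_taylor]; exact h.natDegree_left
    · rw [natDegree_taylor]; exact h.natDegree_right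
  natDegree_right := by rw [natDegree_taylor]; exact h.natDegree_right
  eval_ne x hx hx' := by
    rw [taylor_eval] at hx'
    rw [eval_translateLeft, hx', mul_zero, sub_zero] at hx
    exact h.eval_ne _ hx hx'
  coeff_ne hx hx' := by
    rw [coeff_taylor_of_natDegree_le a h.natDegree_right] at hx'
    rw [coeff_translateLeft h, hx', mul_zero, sub_zero] at hx
    exact h.coeff_ne hx hx'

lemma semiconj_translate (h : IsPair d P Q) : Function.Semiconj (translate a)
    (pairMap d (translateLeft a P Q) (taylor a Q)) (pairMap d P Q) := by
  intro x
  induction x using OnePoint.rec with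
  | infty =>
    have hQ := coeff_taylor_of_natDegree_le a h.natDegree_right
    by_cases h0 : Q.coeff d = 0
    · rw [pairMap_infty_of_eq (hQ.trans h0), translate_infty, pairMap_infty_of_eq h0]
    · rw [pairMap_infty_of_ne (by rwa [hQ]), translate_infty, pairMap_infty_of_ne h0, translate_coe,
        coeff_translateLeft h, hQ]
      congr 1
      field_simp
      ring
  | coe z =>
    have hQ : (taylor a Q).eval z = Q.eval (z + a) := taylor_eval _ _ _
    by_cases h0 : Q.eval (z + a) = 0
    · rw [pairMap_coe_of_eq (hQ.trans h0), translate_infty, translate_coe, pairMap_coe_of_eq h0]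
    · rw [pairMap_coe_of_ne (by rwa [hQ]), translate_coe, translate_coe, pairMap_coe_of_ne h0,
        eval_translateLeft, hQ]
      congr 1
      field_simp
      ring

lemma pairWronsk_translate (hd : 1 ≤ d) (h : IsPair d P Q) (x : OnePoint K) :
    pairWronsk d (translateLeft a P Q) (taylor a Q) x = pairWronsk d P Q (translate a x) := by
  induction x using OnePoint.rec with
  | infty =>
    simp only [pairWronsk, translate_infty]
    rw [coeff_translateLeft h, coeff_translateLeft_pred hd h,
      coeff_taylor_of_natDegree_le a h.natDegree_right, coeff_taylor_pred a hd h.natDegree_right]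
    ring
  | coe z => exact wronsk_translate a P Q z

lemma AttractsCritical.of_translate [IsUltrametricDist K] (hd : 1 ≤ d) (h : IsPair d P Q)
    {γ : OnePoint K}
    (hγ : AttractsCritical d (translateLeft a P Q) (taylor a Q) γ) :
    AttractsCritical d P Q (translate a γ) :=
  hγ.of_semiconj (translate a) (translate_injective a) _ (chordal_translate_le a)
    (semiconj_translate h) fun x hx => by rwa [← pairWronsk_translate hd h]

end Translate

/-! ### Conjugation by the inversion -/

section Invert

variable {P Q : K[X]} {d : ℕ}

lemma coeff_reflect_self (p : K[X]) : (reflect d p).coeff d = p.coeff 0 := by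
  rw [coeff_reflect, revAt_le le_rfl, Nat.sub_self]

lemma coeff_reflect_pred (hd : 1 ≤ d) (p : K[X]) : (reflect d p).coeff (d - 1) = p.coeff 1 := by
  rw [coeff_reflect, revAt_le (Nat.sub_le _ _)]
  congr 1
  omega

lemma coeff_reflect_zero (p : K[X]) : (reflect d p).coeff 0 = p.coeff d := by
  rw [coeff_reflect, revAt_le (Nat.zero_le _), Nat.sub_zero]

lemma coeff_reflect_one (hd : 1 ≤ d) (p : K[X]) : (reflect d p).coeff 1 = p.coeff (d - 1) := by
  rw [coeff_reflect, revAt_le hd]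

lemma eval_reflect {p : K[X]} (hp : p.natDegree ≤ d) {x : K} (hx : x ≠ 0) :
    (reflect d p).eval x = x ^ d * p.eval x⁻¹ := by
  let : Invertible x⁻¹ := invertibleOfNonzero (inv_ne_zero hx)
  have := eval₂_reflect_mul_pow (RingHom.id K) x⁻¹ d p hp
  rw [eval₂_id, eval₂_id, invOf_eq_inv, inv_inv, inv_pow] at this
  rw [← this]
  field_simp

lemma wronsk_eval_zero (p q : K[X]) :
    (wronsk p q).eval 0 = p.coeff 1 * q.coeff 0 - p.coeff 0 * q.coeff 1 := by
  rw [wronsk, eval_sub, eval_mul, eval_mul, ← coeff_zero_eq_eval_zero, ← coeff_zero_eq_eval_zero,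
    ← coeff_zero_eq_eval_zero, ← coeff_zero_eq_eval_zero, coeff_derivative, coeff_derivative]
  simp

/-- The Euler operator `X * d/dX` multiplies the monomial of degree `i` by `i`, and reflection
exchanges `i` and `d - i`. -/
lemma X_mul_derivative_reflect {p : K[X]} (hp : p.natDegree ≤ d) :
    X * derivative (reflect d p) = C (d : K) * reflect d p - reflect d (X * derivative p) := by
  ext i
  rw [coeff_X_mul_derivative, coeff_sub, coeff_C_mul, coeff_reflect, coeff_reflect,
    coeff_X_mul_derivative]
  rcases le_or_gt i d with h | h
  · rw [revAt_le h, Nat.cast_sub h]; ring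
  · rw [revAt_eq_self_of_lt h, coeff_eq_zero_of_natDegree_lt (hp.trans_lt h)]; ring

lemma natDegree_X_mul_derivative_le (p : K[X]) : (X * derivative p).natDegree ≤ p.natDegree := by
  refine natDegree_le_iff_coeff_eq_zero.2 fun i hi => ?_
  rw [coeff_X_mul_derivative, coeff_eq_zero_of_natDegree_lt hi, mul_zero]

/-- Writing both derivatives with the Euler operator, the terms with factor `d` cancel by
antisymmetry. The factor `x ^ 2` comes from the derivative of `1 / x`. -/
lemma wronsk_reflect (h : IsPair d P Q) {x : K} (hx : x ≠ 0) :
    x ^ 2 * (wronsk (reflect d Q) (reflect d P)).eval x =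
      x ^ d * x ^ d * (wronsk P Q).eval x⁻¹ := by
  have key : ∀ p : K[X], p.natDegree ≤ d → x * (derivative (reflect d p)).eval x =
      d * (x ^ d * p.eval x⁻¹) - x ^ d * (x⁻¹ * (derivative p).eval x⁻¹) := fun p hp => by
    have := congrArg (eval x) (X_mul_derivative_reflect hp)
    rwa [eval_mul, eval_X, eval_sub, eval_mul, eval_C, eval_reflect hp hx,
      eval_reflect ((natDegree_X_mul_derivative_le p).trans hp) hx, eval_mul, eval_X] at this
  have hP := key P h.natDegree_left
  have hQ := key Q h.natDegree_right
  simp only [wronsk, eval_sub, eval_mul]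
  rw [eval_reflect h.natDegree_left hx, eval_reflect h.natDegree_right hx]
  have : x ^ 2 * (eval x (derivative (reflect d Q)) * (x ^ d * eval x⁻¹ P) -
      x ^ d * eval x⁻¹ Q * eval x (derivative (reflect d P))) =
      x * ((x * eval x (derivative (reflect d Q))) * (x ^ d * eval x⁻¹ P) -
      x ^ d * eval x⁻¹ Q * (x * eval x (derivative (reflect d P)))) := by ring
  rw [this, hP, hQ]
  field_simp
  ring

lemma IsPair.invert (h : IsPair d P Q) : IsPair d (reflect d Q) (reflect d P) where
  natDegree_left := natDegree_reflect_le.trans (max_le le_rfl h.natDegree_right)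
  natDegree_right := natDegree_reflect_le.trans (max_le le_rfl h.natDegree_left)
  eval_ne x hx hx' := by
    rcases eq_or_ne x 0 with rfl | h0
    · rw [← coeff_zero_eq_eval_zero, coeff_reflect_zero] at hx hx'
      exact h.coeff_ne hx' hx
    · rw [eval_reflect h.natDegree_right h0, mul_eq_zero] at hx
      rw [eval_reflect h.natDegree_left h0, mul_eq_zero] at hx'
      exact h.eval_ne _ (hx'.resolve_left (pow_ne_zero _ h0)) (hx.resolve_left (pow_ne_zero _ h0))
  coeff_ne hx hx' := by
    rw [coeff_reflect_self, coeff_zero_eq_eval_zero] at hx hx'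
    exact h.eval_ne _ hx' hx

lemma invert_ratioPoint {u v : K} (huv : u ≠ 0 ∨ v ≠ 0) :
    invert (ratioPoint v u) = ratioPoint u v := by
  unfold ratioPoint
  by_cases hu : u = 0
  · have hv := huv.resolve_left (not_not.2 hu)
    rw [if_pos hu, if_neg hv, hu, zero_div, invert_infty]
  · rw [if_neg hu]
    by_cases hv : v = 0
    · rw [if_pos hv, hv, zero_div, invert_zero]
    · rw [if_neg hv, invert_coe (div_ne_zero hv hu), inv_div]

lemma ratioPoint_mul_left {c : K} (hc : c ≠ 0) (u v : K) :
    ratioPoint (c * u) (c * v) = ratioPoint u v := by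
  unfold ratioPoint
  by_cases hv : v = 0
  · simp [hv]
  · rw [if_neg hv, if_neg (mul_ne_zero hc hv), mul_div_mul_left _ _ hc]

lemma semiconj_invert (h : IsPair d P Q) : Function.Semiconj invert
    (pairMap d (reflect d Q) (reflect d P)) (pairMap d P Q) := by
  intro x
  induction x using OnePoint.rec with
  | infty =>
    rw [invert_infty]
    simp only [pairMap, coeff_reflect_self, coeff_zero_eq_eval_zero]
    exact invert_ratioPoint (or_iff_not_imp_left.2 fun hp => h.eval_ne _ (not_not.1 hp))
  | coe z =>
    rcases eq_or_ne z 0 with rfl | h0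
    · rw [invert_zero]
      simp only [pairMap, ← coeff_zero_eq_eval_zero, coeff_reflect_zero]
      exact invert_ratioPoint (or_iff_not_imp_left.2 fun hp => h.coeff_ne (not_not.1 hp))
    · rw [invert_coe h0]
      have hz := pow_ne_zero d h0
      simp only [pairMap, eval_reflect h.natDegree_left h0, eval_reflect h.natDegree_right h0,
        ratioPoint_mul_left hz]
      exact invert_ratioPoint (or_iff_not_imp_left.2 fun hp => h.eval_ne _ (not_not.1 hp))

lemma pairWronsk_invert (hd : 1 ≤ d) (h : IsPair d P Q) {x : OnePoint K}
    (hx : pairWronsk d (reflect d Q) (reflect d P) x = 0) :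
    pairWronsk d P Q (invert x) = 0 := by
  induction x using OnePoint.rec with
  | infty =>
    rw [invert_infty]
    simp only [pairWronsk, coeff_reflect_self, coeff_reflect_pred hd] at hx
    simp only [pairWronsk, wronsk_eval_zero]
    linear_combination -hx
  | coe z =>
    rcases eq_or_ne z 0 with rfl | h0
    · rw [invert_zero]
      simp only [pairWronsk, wronsk_eval_zero, coeff_reflect_zero, coeff_reflect_one hd] at hx
      simp only [pairWronsk]
      linear_combination -hx
    · rw [invert_coe h0]
      simp only [pairWronsk] at hx ⊢
      have := wronsk_reflect h h0
      rw [hx, mul_zero, eq_comm, mul_eq_zero] at this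
      exact this.resolve_left (mul_ne_zero (pow_ne_zero _ h0) (pow_ne_zero _ h0))

lemma AttractsCritical.of_invert (hd : 1 ≤ d) (h : IsPair d P Q) {γ : OnePoint K}
    (hγ : AttractsCritical d (reflect d Q) (reflect d P) γ) :
    AttractsCritical d P Q (invert γ) :=
  hγ.of_semiconj invert (Function.LeftInverse.injective invert_invert) 1
    (fun x y => by rw [one_mul, chordal_invert])
    (semiconj_invert h) fun _ hx => pairWronsk_invert hd h hx

lemma pairMult_invert_zero (hd : 1 ≤ d) :
    pairMult d (reflect d Q) (reflect d P) ((0 : K) : OnePoint K) = pairMult d P Q ∞ := by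
  have h0 : (reflect d P).eval 0 = P.coeff d := by
    rw [← coeff_zero_eq_eval_zero, coeff_reflect_zero]
  simp only [pairMult, wronsk_eval_zero, coeff_reflect_zero, coeff_reflect_one hd, h0]

lemma pairMult_invert_infty (hd : 1 ≤ d) :
    pairMult d (reflect d Q) (reflect d P) ∞ = pairMult d P Q ((0 : K) : OnePoint K) := by
  simp only [pairMult, wronsk_eval_zero, coeff_reflect_self, coeff_reflect_pred hd]
  rw [coeff_zero_eq_eval_zero Q]

end Invert

end Pairs

/-! ### From the normalized case to an arbitrary fixed point -/

section Attraction

variable {K : Type*} [NormedField K] [IsAlgClosed K]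
  {P Q : K[X]} {d : ℕ} {μ : ℝ}

/-- If `∞` is an attracting fixed point, then there is a second, finite fixed point. -/
lemma exists_finite_fixed_point (hd : 1 ≤ d) (h : IsPair d P Q) (hinf : pairMap d P Q ∞ = ∞)
    (hmult : pairMult d P Q ∞ ≠ 1) :
    ∃ β : K, pairMap d P Q (β : OnePoint K) = (β : OnePoint K) := by
  have hQd := coeff_eq_zero_of_pairMap_infty hinf
  have hPd : P.coeff d ≠ 0 := fun hP => h.coeff_ne hP hQd
  -- The finite fixed points are the roots of `P - X Q`. Its coefficient of degree `d` vanishes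
  -- exactly when the multiplier `Q.coeff (d - 1) / P.coeff d` at `∞` is 1.
  have hco : (P - X * Q).coeff d ≠ 0 := by
    obtain ⟨e, rfl⟩ := Nat.exists_eq_add_of_le' hd
    rw [coeff_sub, coeff_X_mul]
    intro h0
    apply hmult
    simp only [pairMult, Nat.add_sub_cancel]
    rw [hQd, ← sub_eq_zero.1 h0]
    field_simp
    simp
  have hdeg : (P - X * Q).degree ≠ 0 := by
    intro h0
    have := le_natDegree_of_ne_zero hco
    rw [natDegree_eq_of_degree_eq_some (n := 0) h0] at this
    omega
  obtain ⟨β, hβ⟩ := IsAlgClosed.exists_root _ hdeg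
  have hβ' : P.eval β = β * Q.eval β := by
    simpa [IsRoot, sub_eq_zero] using hβ
  have hQ : Q.eval β ≠ 0 := fun hQ => h.eval_ne β (by rw [hβ', hQ, mul_zero]) hQ
  refine ⟨β, ?_⟩
  rw [pairMap_coe_of_ne hQ, hβ', mul_div_cancel_right₀ _ hQ]

variable [IsUltrametricDist K]

/-- One step takes the critical point into the open disc of radius `r`, minus 0; from there each
step multiplies the absolute value by exactly `ρ`, where `0 < ρ < 1`. -/
lemma IsNormalized.attractsCritical {r : ℝ} (N : IsNormalized P Q d μ r) :
    AttractsCritical d P Q ((0 : K) : OnePoint K) := by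
  obtain ⟨w, hw, hPw, hlt⟩ := N.exists_critical
  have hr := N.radius_pos
  have hQw : Q.eval w ≠ 0 := by
    intro h
    rw [h, norm_zero, mul_zero] at hlt
    exact not_lt.2 (norm_nonneg _) hlt
  have hQ0 : 0 < ‖Q.eval 0‖ := norm_pos_iff.2 (N.right_eval_ne N.eval_zero)
  have hP0 : 0 < ‖P.derivative.eval 0‖ := norm_pos_iff.2 N.derivative_ne
  set ρ : ℝ := ‖P.derivative.eval 0‖ / ‖Q.eval 0‖ with hρ
  have hρ0 : 0 < ρ := div_pos hP0 hQ0
  have hρ1 : ρ < 1 := by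
    rw [hρ, div_lt_one hQ0]
    refine N.lt.trans_le (mul_le_of_le_one_left hQ0.le ?_)
    exact pow_le_one₀ N.pos.le N.le_one
  set z₁ : K := P.eval w / Q.eval w with hz₁
  have hz₁r : ‖z₁‖ < r := by
    rw [hz₁, norm_div, div_lt_iff₀ (norm_pos_iff.2 hQw)]
    exact hlt
  have hit : ∀ n : ℕ, ∃ z : K, (pairMap d P Q)^[n + 1] (w : OnePoint K) = (z : OnePoint K) ∧
      ‖z‖ = ρ ^ n * ‖z₁‖ := by
    intro n
    induction n with
    | zero => exact ⟨z₁, by simpa using pairMap_coe_of_ne hQw, by simp⟩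
    | succ n ih =>
      obtain ⟨z, hz, hzn⟩ := ih
      have hzr : ‖z‖ < r := by
        rw [hzn]
        exact (mul_le_of_le_one_left (norm_nonneg _) (pow_le_one₀ hρ0.le hρ1.le)).trans_lt hz₁r
      obtain ⟨h1, h2⟩ := N.norm_eval hzr
      have hQz : Q.eval z ≠ 0 := norm_pos_iff.1 (h2 ▸ hQ0)
      refine ⟨P.eval z / Q.eval z, ?_, ?_⟩
      · rw [Function.iterate_succ_apply', hz, pairMap_coe_of_ne hQz]
      · rw [norm_div, h1, h2, hzn, pow_succ, hρ]
        ring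
  refine ⟨w, hw, ?_, fun l hl heq => ?_⟩
  · refine (tendsto_add_atTop_iff_nat 1).1 ?_
    refine squeeze_zero (g := fun n => ρ ^ n * ‖z₁‖) (fun n => chordal_nonneg _ _) (fun n => ?_) ?_
    · obtain ⟨z, hz, hzn⟩ := hit n
      rw [hz, chordal_coe_coe, ← hzn, sub_zero, norm_zero, max_eq_left zero_le_one, mul_one]
      exact div_le_self (norm_nonneg _) (le_max_left _ _)
    · simpa using (tendsto_pow_atTop_nhds_zero_of_lt_one hρ0.le hρ1).mul_const ‖z₁‖
  · obtain ⟨n, rfl⟩ := Nat.exists_eq_add_of_le' hl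
    obtain ⟨z, hz, hzn⟩ := hit n
    rw [hz, OnePoint.coe_eq_coe] at heq
    rw [heq, norm_zero] at hzn
    exact (mul_ne_zero (pow_pos hρ0 n).ne' (norm_pos_iff.2 (div_ne_zero hPw hQw)).ne') hzn.symm

/-- Here `r` is the least absolute value of a nonzero zero or pole. One exists because 0 is a simple
zero of `P` and `deg P = d ≥ 2`. -/
lemma attractsCritical_of_infty_fixed (hd : 2 ≤ d) (hμ : 0 < μ)
    (hμd : ∀ m : ℕ, 1 ≤ m → m ≤ d → μ ≤ ‖(m : K)‖) (h : IsPair d P Q)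
    (h0 : pairMap d P Q ((0 : K) : OnePoint K) = ((0 : K) : OnePoint K))
    (hinf : pairMap d P Q ∞ = ∞)
    (hpos : 0 < ‖pairMult d P Q ((0 : K) : OnePoint K)‖)
    (hlt : ‖pairMult d P Q ((0 : K) : OnePoint K)‖ < μ ^ d) :
    AttractsCritical d P Q ((0 : K) : OnePoint K) := by
  classical
  obtain ⟨hQ0, hP0⟩ := pairMap_coe_eq_coe h0
  rw [zero_mul] at hP0
  have hQd := coeff_eq_zero_of_pairMap_infty hinf
  have hPd : P.coeff d ≠ 0 := fun hP => h.coeff_ne hP hQd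
  have hPdeg : P.natDegree = d := le_antisymm h.natDegree_left (le_natDegree_of_ne_zero hPd)
  have hQne : Q ≠ 0 := by
    rintro rfl
    simp at hQ0
  have hPne : P ≠ 0 := by
    rintro rfl
    simp at hPd
  have hQdeg : Q.natDegree < d := lt_of_le_of_ne h.natDegree_right fun hq =>
    hQne (leadingCoeff_eq_zero.1 (by rw [leadingCoeff, hq, hQd]))
  have hmult : ‖pairMult d P Q ((0 : K) : OnePoint K)‖ =
      ‖P.derivative.eval 0‖ / ‖Q.eval 0‖ := by
    rw [← norm_div]
    congr 1
    simp only [pairMult, wronsk, eval_sub, eval_mul, hP0, zero_mul, sub_zero]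
    field_simp
  rw [hmult] at hpos hlt
  have hQn : 0 < ‖Q.eval 0‖ := norm_pos_iff.2 hQ0
  have hP' : P.derivative.eval 0 ≠ 0 := by
    intro h'
    rw [h', norm_zero, zero_div] at hpos
    exact lt_irrefl _ hpos
  obtain ⟨P₁, hP₁⟩ := dvd_iff_isRoot.2 (show P.IsRoot 0 from hP0)
  rw [C_0, sub_zero] at hP₁
  have hP₁ne : P₁ ≠ 0 := by
    rintro rfl
    exact hPne (by simpa using hP₁)
  have hP₁deg : P₁.degree ≠ 0 := by
    intro hdeg
    rw [hP₁, natDegree_mul X_ne_zero hP₁ne, natDegree_X, natDegree_eq_of_degree_eq_some (n := 0) hdeg] at hPdeg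
    omega
  obtain ⟨α, hα⟩ := IsAlgClosed.exists_root P₁ hP₁deg
  have hα0 : α ≠ 0 := by
    rintro rfl
    apply hP'
    rw [hP₁]
    simpa using hα
  have hαP : α ∈ P.roots := by
    rw [mem_roots hPne, hP₁]
    exact root_mul_left_of_isRoot _ hα
  set S : Finset K := (P.roots + Q.roots).toFinset.erase 0 with hS
  have hSmem : ∀ β, β ∈ S ↔ β ≠ 0 ∧ (β ∈ P.roots ∨ β ∈ Q.roots) := fun β => by
    rw [hS, Finset.mem_erase, Multiset.mem_toFinset, Multiset.mem_add]
  obtain ⟨β, hβ, hmin⟩ := S.exists_min_image (fun β => ‖β‖) ⟨α, (hSmem α).2 ⟨hα0, Or.inl hαP⟩⟩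
  have hβ' := (hSmem β).1 hβ
  refine IsNormalized.attractsCritical (μ := μ) (r := ‖β‖)
    { right_eval_ne := fun {a} => h.eval_ne a
      natDegree_left := hPdeg
      natDegree_right := hQdeg
      eval_zero := hP0
      derivative_ne := hP'
      pos := hμ
      le_norm := hμd
      lt := (div_lt_iff₀ hQn).1 hlt
      radius_pos := norm_pos_iff.2 hβ'.1
      le_left := fun α hα hα0 => hmin α ((hSmem α).2 ⟨hα0, Or.inl hα⟩)
      le_right := fun α hα => hmin α ((hSmem α).2 ⟨?_, Or.inr hα⟩)
      exists_root := ⟨β, hβ'.2, rfl⟩ }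
  rintro rfl
  exact hQ0 (isRoot_of_mem_roots hα)

/-- The second fixed point is moved to 0; the inversion then exchanges it with the attracting point,
and the multiplier is unchanged. -/
lemma attractsCritical_infty (hd : 2 ≤ d) (hμ : 0 < μ)
    (hμd : ∀ m : ℕ, 1 ≤ m → m ≤ d → μ ≤ ‖(m : K)‖) (h : IsPair d P Q)
    (hinf : pairMap d P Q ∞ = ∞)
    (hpos : 0 < ‖pairMult d P Q ∞‖) (hlt : ‖pairMult d P Q ∞‖ < μ ^ d) :
    AttractsCritical d P Q ∞ := by
  have hd1 : 1 ≤ d := one_le_two.trans hd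
  have hμ1 : μ ≤ 1 := by simpa using hμd 1 le_rfl hd1
  have hne : pairMult d P Q ∞ ≠ 1 := by
    intro h1
    rw [h1, norm_one] at hlt
    exact not_le.2 hlt (pow_le_one₀ hμ.le hμ1)
  obtain ⟨β, hβ⟩ := exists_finite_fixed_point hd1 h hinf hne
  have hT := h.translate (a := β)
  have hTβ : pairMap d (translateLeft β P Q) (taylor β Q) ((0 : K) : OnePoint K) =
      ((0 : K) : OnePoint K) := translate_injective β (by
    rw [(semiconj_translate h).eq, translate_coe, zero_add, hβ])
  have hTinf : pairMap d (translateLeft β P Q) (taylor β Q) ∞ = ∞ := translate_injective β (by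
    rw [(semiconj_translate h).eq, translate_infty, hinf])
  have hQd := coeff_eq_zero_of_pairMap_infty hinf
  have hTmult : pairMult d (translateLeft β P Q) (taylor β Q) ∞ = pairMult d P Q ∞ := by
    have := pairWronsk_translate (a := β) hd1 h ∞
    simp only [pairWronsk, translate_infty] at this
    simp only [pairMult]
    rw [coeff_translateLeft h, hQd, mul_zero, sub_zero] at this ⊢
    congr 1
    linear_combination -this
  have hI := hT.invert
  have hII := semiconj_invert hT
  have hinj : Function.Injective (invert : OnePoint K → OnePoint K) :=
    Function.LeftInverse.injective invert_invert
  refine AttractsCritical.of_translate hd1 h (a := β) (γ := ∞) ?_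
  rw [← invert_zero]
  refine AttractsCritical.of_invert hd1 hT
    (attractsCritical_of_infty_fixed hd hμ hμd hI (hinj ?_) (hinj ?_) ?_ ?_)
  · rw [hII.eq, invert_zero, hTinf]
  · rw [hII.eq, invert_infty, hTβ]
  · rwa [pairMult_invert_zero hd1, hTmult]
  · rwa [pairMult_invert_zero hd1, hTmult]

/-- An attracting fixed point of a rational function of degree `d` whose multiplier is nonzero and
less than `μ ^ d` strictly attracts a critical point. -/
theorem attractsCritical (hd : 2 ≤ d) (hμ : 0 < μ)
    (hμd : ∀ m : ℕ, 1 ≤ m → m ≤ d → μ ≤ ‖(m : K)‖) (h : IsPair d P Q) {γ : OnePoint K}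
    (hγ : pairMap d P Q γ = γ)
    (hpos : 0 < ‖pairMult d P Q γ‖) (hlt : ‖pairMult d P Q γ‖ < μ ^ d) :
    AttractsCritical d P Q γ := by
  have hd1 : 1 ≤ d := one_le_two.trans hd
  induction γ using OnePoint.rec with
  | infty => exact attractsCritical_infty hd hμ hμd h hγ hpos hlt
  | coe a =>
    have hT := h.translate (a := a)
    have hTa : pairMap d (translateLeft a P Q) (taylor a Q) ((0 : K) : OnePoint K) =
        ((0 : K) : OnePoint K) := translate_injective a (by
      rw [(semiconj_translate h).eq, translate_coe, zero_add, hγ])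
    have hTmult : pairMult d (translateLeft a P Q) (taylor a Q) ((0 : K) : OnePoint K) =
        pairMult d P Q (a : OnePoint K) := by
      simp only [pairMult]
      rw [wronsk_translate, taylor_eval, zero_add]
    have hinj : Function.Injective (invert : OnePoint K → OnePoint K) :=
      Function.LeftInverse.injective invert_invert
    -- A finite fixed point is first sent to `∞`, where the existence of a second fixed point is
    -- available.
    have key : AttractsCritical d (translateLeft a P Q) (taylor a Q) (invert ∞) := by
      refine AttractsCritical.of_invert hd1 hT
        (attractsCritical_infty hd hμ hμd hT.invert (hinj ?_) ?_ ?_)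
      · rw [(semiconj_invert hT).eq, invert_infty, hTa]
      · rwa [pairMult_invert_infty hd1, hTmult]
      · rwa [pairMult_invert_infty hd1, hTmult]
    rw [invert_infty] at key
    have := AttractsCritical.of_translate hd1 h key
    rwa [translate_coe, zero_add] at this

end Attraction

/-! ### Comparison of rational functions with pairs of polynomials -/

section RationalFunctions

variable {K : Type*} [NormedField K] {A B : K[X]}

/-- A coprime fraction is unique up to a common constant, so values and derivatives can be computed
from any coprime representation. -/
lemma exists_eq_C_mul_num_denom (hB : B ≠ 0) (h : IsCoprime A B) {φ : RatFunc K}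
    (hφ : φ = algebraMap K[X] (RatFunc K) A / algebraMap K[X] (RatFunc K) B) :
    ∃ c : K, c ≠ 0 ∧ A = C c * φ.num ∧ B = C c * φ.denom := by
  have hnd : φ.num * B = A * φ.denom := (RatFunc.num_mul_eq_mul_denom_iff hB).2 hφ
  obtain ⟨u, hu⟩ : φ.denom ∣ B :=
    (RatFunc.isCoprime_num_denom φ).symm.dvd_of_dvd_mul_left ⟨A, by rw [hnd, mul_comm]⟩
  have hA : A = φ.num * u := by
    refine mul_right_cancel₀ (RatFunc.denom_ne_zero φ) ?_
    rw [← hnd, hu]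
    ring
  have hunit : IsUnit u := h.isUnit_of_dvd' ⟨φ.num, by rw [hA, mul_comm]⟩ ⟨φ.denom, by rw [hu, mul_comm]⟩
  obtain ⟨c, hc, rfl⟩ := isUnit_iff.1 hunit
  exact ⟨c, hc.ne_zero, by rw [hA, mul_comm], by rw [hu, mul_comm]⟩

lemma valueAt_div (hB : B ≠ 0) (h : IsCoprime A B) {φ : RatFunc K}
    (hφ : φ = algebraMap K[X] (RatFunc K) A / algebraMap K[X] (RatFunc K) B) (a : K) :
    valueAt φ a = ratioPoint (A.eval a) (B.eval a) := by
  obtain ⟨c, hc, hA, hB⟩ := exists_eq_C_mul_num_denom hB h hφ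
  rw [hA, hB, eval_mul, eval_mul, eval_C, ratioPoint_mul_left hc, valueAt, ratioPoint, RatFunc.eval,
    eval₂_id, eval₂_id]

lemma derivAt_div (hB : B ≠ 0) (h : IsCoprime A B) {φ : RatFunc K}
    (hφ : φ = algebraMap K[X] (RatFunc K) A / algebraMap K[X] (RatFunc K) B) (a : K) :
    derivAt φ a = (wronsk A B).eval a / B.eval a ^ 2 := by
  obtain ⟨c, hc, hA, hB⟩ := exists_eq_C_mul_num_denom hB h hφ
  rw [hA, hB]
  simp only [derivAt, wronsk, derivative_mul, derivative_C, zero_mul, zero_add, eval_sub, eval_mul,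
    eval_C]
  field_simp

/-- Numerator and denominator of `φ(1/X)` are multiplied by the same `X ^ d`, so both are reflected
in the common degree `d` and not in their own degrees. -/
lemma compInv_eq (φ : RatFunc K) {d : ℕ} (hP : φ.num.natDegree ≤ d) (hQ : φ.denom.natDegree ≤ d) :
    compInv φ = algebraMap K[X] (RatFunc K) (reflect d φ.num) /
      algebraMap K[X] (RatFunc K) (reflect d φ.denom) := by
  have hX : (RatFunc.X : RatFunc K) ≠ 0 := RatFunc.X_ne_zero
  let : Invertible (RatFunc.X : RatFunc K)⁻¹ := invertibleOfNonzero (inv_ne_zero hX)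
  have key : ∀ f : K[X], f.natDegree ≤ d → eval₂ RatFunc.C (RatFunc.X : RatFunc K)⁻¹ f =
      algebraMap K[X] (RatFunc K) (reflect d f) * (RatFunc.X : RatFunc K)⁻¹ ^ d := by
    intro f hf
    rw [← eval₂_reflect_mul_pow RatFunc.C (RatFunc.X : RatFunc K)⁻¹ d f hf, invOf_eq_inv, inv_inv,
      ← RatFunc.aeval_X_left_eq_algebraMap, aeval_def, RatFunc.algebraMap_eq_C]
  rw [compInv, RatFunc.eval, key _ hP, key _ hQ,
    mul_div_mul_right _ _ (pow_ne_zero _ (inv_ne_zero hX))]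

variable {d : ℕ} {φ : RatFunc K}

lemma IsPair.symm {P Q : K[X]} (h : IsPair d P Q) :
    IsPair d Q P :=
  ⟨h.natDegree_right, h.natDegree_left, fun a hQ hP => h.eval_ne a hP hQ,
    fun hQ hP => h.coeff_ne hP hQ⟩

lemma wronsk_symm (P Q : K[X]) : wronsk Q P = -wronsk P Q := by
  simp only [wronsk]
  ring

lemma isPair_num_denom (hd : 1 ≤ d) (hφ : degree φ = d) : IsPair d φ.num φ.denom where
  natDegree_left := hφ ▸ le_max_left _ _
  natDegree_right := hφ ▸ le_max_right _ _
  eval_ne a ha ha' := by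
    obtain ⟨u, v, huv⟩ := RatFunc.isCoprime_num_denom φ
    have := congrArg (eval a) huv
    simp [ha, ha'] at this
  coeff_ne hP hQ := by
    have key : ∀ p : K[X], p.natDegree = d → p.coeff d = 0 → False := by
      rintro p rfl hp
      rw [coeff_natDegree, leadingCoeff_eq_zero] at hp
      rw [hp] at hd
      simp at hd
    rcases max_choice φ.num.natDegree φ.denom.natDegree with h | h
    · exact key _ (h.symm.trans hφ) hP
    · exact key _ (h.symm.trans hφ) hQ

variable [IsAlgClosed K]

lemma IsPair.isCoprime {P Q : K[X]} (h : IsPair d P Q) : IsCoprime P Q := by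
  refine isCoprime_of_irreducible_dvd ?_ ?_
  · rintro ⟨rfl, rfl⟩
    exact h.eval_ne 0 (by simp) (by simp)
  · intro p hp hpP hpQ
    obtain ⟨a, ha⟩ := IsAlgClosed.exists_root p (degree_pos_of_irreducible hp).ne'
    exact h.eval_ne a (IsRoot.dvd ha hpP) (IsRoot.dvd ha hpQ)

lemma IsPair.right_ne {P Q : K[X]} (h : IsPair d P Q) (hd : 1 ≤ d) : Q ≠ 0 := by
  rintro rfl
  have hP : P.coeff d ≠ 0 := fun hP => h.coeff_ne hP (coeff_zero d)
  obtain ⟨a, ha⟩ := IsAlgClosed.exists_root P (fun h0 => by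
    have := le_natDegree_of_ne_zero hP
    rw [natDegree_eq_of_degree_eq_some (n := 0) h0] at this
    omega)
  exact h.eval_ne a ha (by simp)

/-- The numerator and denominator of `φ` in the standard coordinate of the source at `x`. -/
lemma exists_sourceForm (hd : 1 ≤ d) (hφ : degree φ = d) (x : OnePoint K) :
    ∃ A B : K[X], IsPair d A B ∧
      sourceForm φ x = algebraMap K[X] (RatFunc K) A / algebraMap K[X] (RatFunc K) B ∧
      toMap φ x = ratioPoint (A.eval (coordAt x)) (B.eval (coordAt x)) ∧
      pairMap d φ.num φ.denom x = toMap φ x ∧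
      pairWronsk d φ.num φ.denom x = (wronsk A B).eval (coordAt x) ∧
      (x = ∞ → pairMult d φ.num φ.denom x =
        (wronsk B A).eval (coordAt x) / A.eval (coordAt x) ^ 2) ∧
      (x ≠ ∞ → pairMult d φ.num φ.denom x =
        (wronsk A B).eval (coordAt x) / B.eval (coordAt x) ^ 2) := by
  have h := isPair_num_denom hd hφ
  have main : ∀ {A B : K[X]} {ψ : RatFunc K} (a : K), IsPair d A B →
      ψ = algebraMap K[X] (RatFunc K) A / algebraMap K[X] (RatFunc K) B →
      valueAt ψ a = ratioPoint (A.eval a) (B.eval a) := fun a hAB hψ =>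
    valueAt_div (hAB.right_ne hd) hAB.isCoprime hψ a
  induction x using OnePoint.rec with
  | infty =>
    have hr := h.invert.symm
    have hc := compInv_eq φ h.natDegree_left h.natDegree_right
    have ht : toMap φ ∞ = _ := main 0 hr hc
    have hev : ∀ p : K[X], (reflect d p).eval 0 = p.coeff d := fun p => by
      rw [← coeff_zero_eq_eval_zero, coeff_reflect_zero]
    refine ⟨reflect d φ.num, reflect d φ.denom, hr, hc, ht, ?_, ?_, fun _ => ?_, fun h => absurd rfl h⟩
    · rw [ht, hev, hev]; rfl
    · simp only [coordAt, wronsk_eval_zero, coeff_reflect_zero, coeff_reflect_one hd]; rfl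
    · simp only [coordAt, wronsk_eval_zero, coeff_reflect_zero, coeff_reflect_one hd, hev]; rfl
  | coe a =>
    have hs := (RatFunc.num_div_denom φ).symm
    have ht : toMap φ (a : OnePoint K) = _ := main a h hs
    exact ⟨φ.num, φ.denom, h, hs, ht, ht.symm, rfl,
      fun h => absurd h (OnePoint.coe_ne_infty a), fun _ => rfl⟩

lemma toMap_eq_pairMap (hd : 1 ≤ d) (hφ : degree φ = d) :
    toMap φ = pairMap d φ.num φ.denom := by
  funext x
  obtain ⟨A, B, -, -, -, h, -⟩ := exists_sourceForm hd hφ x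
  exact h.symm

lemma localDeriv_eq (hd : 1 ≤ d) {x : OnePoint K} (hAB : IsPair d A B)
    (hs : sourceForm φ x = algebraMap K[X] (RatFunc K) A / algebraMap K[X] (RatFunc K) B) :
    (toMap φ x = ∞ → localDeriv φ x = (wronsk B A).eval (coordAt x) / A.eval (coordAt x) ^ 2) ∧
    (toMap φ x ≠ ∞ → localDeriv φ x = (wronsk A B).eval (coordAt x) / B.eval (coordAt x) ^ 2) := by
  refine ⟨fun h => ?_, fun h => ?_⟩
  · rw [localDeriv, localForm, if_pos h]
    exact derivAt_div (hAB.symm.right_ne hd) hAB.symm.isCoprime (by rw [hs, inv_div]) _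
  · rw [localDeriv, localForm, if_neg h]
    exact derivAt_div (hAB.right_ne hd) hAB.isCoprime hs _

lemma isCriticalPoint_of_pairWronsk (hd : 1 ≤ d) (hφ : degree φ = d) {x : OnePoint K}
    (h : pairWronsk d φ.num φ.denom x = 0) : IsCriticalPoint φ x := by
  obtain ⟨A, B, hAB, hs, -, -, hw, -, -⟩ := exists_sourceForm hd hφ x
  obtain ⟨h1, h2⟩ := localDeriv_eq hd hAB hs
  rw [hw] at h
  by_cases ht : toMap φ x = ∞
  · rw [IsCriticalPoint, h1 ht, wronsk_symm, eval_neg, h, neg_zero, zero_div]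
  · rw [IsCriticalPoint, h2 ht, h, zero_div]

lemma pairMult_eq_localDeriv (hd : 1 ≤ d) (hφ : degree φ = d) {γ : OnePoint K}
    (hγ : toMap φ γ = γ) : pairMult d φ.num φ.denom γ = localDeriv φ γ := by
  obtain ⟨A, B, hAB, hs, -, -, -, hm₁, hm₂⟩ := exists_sourceForm hd hφ γ
  obtain ⟨h1, h2⟩ := localDeriv_eq hd hAB hs
  rw [hγ] at h1 h2
  by_cases h : γ = ∞
  · rw [hm₁ h, h1 h]
  · rw [hm₂ h, h2 h]

end RationalFunctions

/-! ### The constant `ε` -/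

lemma epsilon_pos {K : Type*} [NormedField K] {d : ℕ} (hd : 1 ≤ d)
    (h : ∀ m : ℕ, 1 ≤ m → m ≤ d → (m : K) ≠ 0) : 0 < epsilon K d hd :=
  (Finset.lt_inf'_iff _).2 fun m hm =>
    pow_pos (norm_pos_iff.2 (h m (Finset.mem_Icc.1 hm).1 (Finset.mem_Icc.1 hm).2)) d

lemma epsilon_le_one {K : Type*} [NormedField K] {d : ℕ} (hd : 1 ≤ d) : epsilon K d hd ≤ 1 :=
  (Finset.inf'_le _ (Finset.mem_Icc.2 ⟨le_rfl, hd⟩)).trans (by simp)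

/-- Taking `d`-th powers is monotone, so `ε = μ ^ d` with `μ = |m₀|` the least absolute value of an
integer from 1 to `d`. -/
lemma exists_epsilon_eq_pow (K : Type*) [NormedField K] {d : ℕ} (hd : 1 ≤ d) :
    ∃ m₀ : ℕ, 1 ≤ m₀ ∧ m₀ ≤ d ∧ epsilon K d hd = ‖(m₀ : K)‖ ^ d ∧
      ∀ m : ℕ, 1 ≤ m → m ≤ d → ‖(m₀ : K)‖ ≤ ‖(m : K)‖ := by
  obtain ⟨m₀, hm₀, heq⟩ := Finset.exists_mem_eq_inf' (Finset.nonempty_Icc.mpr hd)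
    (fun m : ℕ => ‖(m : K)‖ ^ d)
  obtain ⟨h1, h2⟩ := Finset.mem_Icc.1 hm₀
  refine ⟨m₀, h1, h2, heq, fun m hm hmd => ?_⟩
  refine le_of_pow_le_pow_left₀ (Nat.one_le_iff_ne_zero.1 hd) (norm_nonneg _) ?_
  rw [← heq]
  exact Finset.inf'_le (fun m : ℕ => ‖(m : K)‖ ^ d) (Finset.mem_Icc.2 ⟨hm, hmd⟩)

lemma natCast_ne_zero_of_ringChar {K : Type*} [Field K] {d : ℕ}
    (h : ringChar K = 0 ∨ d < ringChar K) (m : ℕ) (hm : 1 ≤ m) (hmd : m ≤ d) : (m : K) ≠ 0 := by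
  intro h0
  have hdvd := (ringChar.spec K m).1 h0
  rcases h with h | h
  · rw [h, zero_dvd_iff] at hdvd
    omega
  · exact absurd (Nat.le_of_dvd hm hdvd) (by omega)

end RationalDynamics

end

theorem theorem1p2 {K : Type*} [NontriviallyNormedField K] [IsUltrametricDist K] [CompleteSpace K]
    [IsAlgClosed K] (d : ℕ) (hd : 2 ≤ d) (hchar : ringChar K = 0 ∨ d < ringChar K) :
    0 < RationalDynamics.epsilon K d (one_le_two.trans hd) ∧
    RationalDynamics.epsilon K d (one_le_two.trans hd) ≤ 1 ∧
    ∀ (φ : RatFunc K), RationalDynamics.degree φ = d →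
      ∀ γ : OnePoint K, RationalDynamics.toMap φ γ = γ →
        0 < ‖RationalDynamics.localDeriv φ γ‖ →
        ‖RationalDynamics.localDeriv φ γ‖ < RationalDynamics.epsilon K d (one_le_two.trans hd) →
        ∃ c : OnePoint K, RationalDynamics.IsCriticalPoint φ c ∧
          RationalDynamics.StrictlyAttracts φ γ c := by
  have hd1 : 1 ≤ d := one_le_two.trans hd
  have hne := RationalDynamics.natCast_ne_zero_of_ringChar hchar
  refine ⟨RationalDynamics.epsilon_pos hd1 hne, RationalDynamics.epsilon_le_one hd1,
    fun φ hφ γ hγ hpos hlt => ?_⟩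
  obtain ⟨m₀, h1, h2, heq, hmin⟩ := RationalDynamics.exists_epsilon_eq_pow K hd1
  rw [heq] at hlt
  rw [← RationalDynamics.pairMult_eq_localDeriv hd1 hφ hγ] at hpos hlt
  obtain ⟨c, hc, hlim, hnever⟩ := RationalDynamics.attractsCritical hd
    (norm_pos_iff.2 (hne m₀ h1 h2)) hmin (RationalDynamics.isPair_num_denom hd1 hφ)
    (by rwa [← RationalDynamics.toMap_eq_pairMap hd1 hφ]) hpos hlt
  rw [← RationalDynamics.toMap_eq_pairMap hd1 hφ] at hlim hnever
  exact ⟨c, RationalDynamics.isCriticalPoint_of_pairWronsk hd1 hφ hc, hlim, hnever⟩
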